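/- Let $q$ be an odd prime power, $\mathbb F_q$ a field with $q$ elements, $c\in\mathbb F_q$ a non-square, and let $t$ be the coordinate of $\mathbb P^1$ over $\mathbb F_q$. For a finite set $S$ of $\mathbb F_q$-rational points of $\mathbb P^1$ containing $B=\{0,\infty\}$ let $\mathfrak o_S\subset\mathbb F_q(t)$ be the ring of rational functions regular outside $S$, and put $$\Lambda_S=\big(\mathfrak o_S\{Z,F\}/(Z^2=c,\ F^2=t,\ ZF+FZ=0)\big)^\times/\mathfrak o_S^\times ,$$ with $[w]\in\Lambda_S$ the class of a unit $w$. Inside the algebra lies the quadratic field extension $\mathbb F_q[Z]=\mathbb F_q\oplus\mathbb F_q Z$ of $\mathbb F_q$, with norm $N(u+vZ)=u^2-cv^2$. For $\tau\in\mathbb F_q^\times$ put $\Lambda_\tau=\Lambda_{\{0,\tau,\infty\}}$, $$PA_\tau=\{[1+\alpha F]\ ;\ \alpha\in\mathbb F_q[Z],\ N(\alpha)=\tau^{-1}\}\subseteq\Lambda_\tau,\qquad \Gamma_\tau=\langle PA_\tau\rangle\subseteq\Lambda_\tau .$$ Let $\delta$ be a generator of $\mathbb F_q[Z]^\times$, $d=[\delta]$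 and $s=[F]$. Put $a_\tau=[1+\alpha_0F]\in PA_\tau$, where $\alpha_0\in\mathbb F_q$ with $\alpha_0^2=\tau^{-1}$ if $\tau$ is a square in $\mathbb F_q$, and $\alpha_0=\alpha_1\delta^{-1}$ with $\alpha_1\in\mathbb F_q$, $\alpha_1^2=\delta^{q+1}\tau^{-1}=N(\delta)\tau^{-1}$, otherwise. Then, for every $\tau\in\mathbb F_q^\times$ and all such choices: 1. $\Gamma_\tau$ is a free group of rank $\frac{q+1}{2}$ on the set $PA_\tau$ considered as a set of generators and their inverses, the inversion being $[1+\alpha F]^{-1}=[1-\alpha F]$. That is, $PA_\tau$ is closed under $a\mapsto a^{-1}$, no $a\in PA_\tau$ equals its inverse, and every subset of $PA_\tau$ that contains exactly one element of each pair $\{a,a^{-1}\}$ has $\frac{q+1}{2}$ elements and is a free basis of $\Gamma_\tau$. 2. The natural map $\Lambda_B\to\Lambda_\tau$ is injective, $\Gamma_\tau$ is a normal subgroup of $\Lambda_\tau$ with complement $\Lambda_B$, so that $\Lambda_\tau=\Gamma_\tau\rtimes\Lambda_B$; the group $\Lambda_B$ is dihedral of order $2(q+1)$ with rotation $d$ of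 order $q+1$ and reflection $s$; and $\Lambda_\tau$ has the presentation $$\Lambda_\tau=\left\langle d,s,a_\tau\ \middle|\ d^{q+1}=s^2=(sd)^2=(d^{(q+1)/2}a_\tau)^2=1,\ \begin{cases} sa_\tau=a_\tau s&\text{if }\tau\text{ is a square in }\mathbb F_q,\\ (sd)a_\tau=a_\tau(sd)&\text{if }\tau\text{ is not a square in }\mathbb F_q\end{cases}\right\rangle .$$ -/

import Mathlib

open Polynomial IsDedekindDomain

namespace QuatLattice

noncomputable section

/-- The finite places of `K = F(t)` at the rational points `t = 0` and `t = σ` for `σ ∈ S₀`. -/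
def places {F : Type*} [Field F] (S₀ : Set F) : Set (HeightOneSpectrum F[X]) :=
  {v | ∃ σ ∈ insert 0 S₀, (X - C σ : F[X]) ∈ v.asIdeal}

/-- The ring of `S`-integers of `K = F(t)` for `S = {0, ∞} ∪ S₀`: the rational functions that are
regular at every place outside `S`. As `∞ ∈ S`, only the places of `F[t]` impose a condition. -/
abbrev SInt {F : Type*} [Field F] (S₀ : Set F) : Subalgebra F[X] (RatFunc F) :=
  (places S₀).integer (RatFunc F)

/-- A polynomial in `t`, seen as an `S`-integer. -/
abbrev poly {F : Type*} [Field F] (S₀ : Set F) : F[X] →+* SInt S₀ :=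
  algebraMap F[X] (SInt S₀)

/-- The quaternion `S`-order `𝔬{Z, F} / (Z² = c, F² = t, ZF + FZ = 0)` over the ring `𝔬` of
`S`-integers; `Z`, `F`, `ZF` are the basis vectors `i`, `j`, `k`. -/
abbrev Quat {F : Type*} [Field F] (c : F) (S₀ : Set F) : Type _ :=
  QuaternionAlgebra (SInt S₀) (poly S₀ (C c)) 0 (poly S₀ X)

/-- The scalar units `𝔬ˣ` inside the unit group of the quaternion order. -/
abbrev scalars {F : Type*} [Field F] (c : F) (S₀ : Set F) : Subgroup (Quat c S₀)ˣ :=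
  (Units.map (algebraMap (SInt S₀) (Quat c S₀)).toMonoidHom).range

instance scalars_normal {F : Type*} [Field F] (c : F) (S₀ : Set F) : (scalars c S₀).Normal where
  conj_mem := by
    rintro _ ⟨u, rfl⟩ g
    refine ⟨u, ?_⟩
    rw [eq_mul_inv_iff_mul_eq]
    ext1
    exact Algebra.commutes (u : SInt S₀) (g : Quat c S₀)

/-- The group `Λ_S`: units of the quaternion order modulo `𝔬ˣ`, for `S = {0, ∞} ∪ S₀`. -/
abbrev Lam {F : Type*} [Field F] (c : F) (S₀ : Set F) : Type _ :=
  (Quat c S₀)ˣ ⧸ scalars c S₀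

/-- The class `[w]` in `Λ_S` of a unit `w`. -/
abbrev cls {F : Type*} [Field F] {c : F} {S₀ : Set F} (w : (Quat c S₀)ˣ) : Lam c S₀ :=
  QuotientGroup.mk w

/-! ### The inclusions `Λ_S ⊆ Λ_T` for `S ⊆ T` -/

lemma places_mono {F : Type*} [Field F] {S₀ T₀ : Set F} (h : S₀ ⊆ T₀) :
    places S₀ ⊆ places T₀ := by
  rintro v ⟨σ, hσ, hv⟩
  exact ⟨σ, Set.insert_subset_insert h hσ, hv⟩

lemma sInt_mono {F : Type*} [Field F] {S₀ T₀ : Set F} (h : S₀ ⊆ T₀) : SInt S₀ ≤ SInt T₀ :=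
  fun _ hx v hv => hx v fun hv' => hv (places_mono h hv')

/-- The inclusion of the quaternion orders, coefficient by coefficient. -/
def quatIncl {F : Type*} [Field F] (c : F) {S₀ T₀ : Set F} (h : S₀ ⊆ T₀) :
    Quat c S₀ →+* Quat c T₀ where
  toFun w := ⟨Subalgebra.inclusion (sInt_mono h) w.re, Subalgebra.inclusion (sInt_mono h) w.imI,
    Subalgebra.inclusion (sInt_mono h) w.imJ, Subalgebra.inclusion (sInt_mono h) w.imK⟩
  map_one' := by ext <;> simp
  map_zero' := by ext <;> simp
  map_add' x y := by ext <;> simp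
  map_mul' x y := by ext <;> simp

/-- The homomorphism `Λ_S → Λ_T` induced by the inclusion of the orders. -/
def lamIncl {F : Type*} [Field F] (c : F) {S₀ T₀ : Set F} (h : S₀ ⊆ T₀) :
    Lam c S₀ →* Lam c T₀ :=
  QuotientGroup.map _ _ (Units.map (quatIncl c h).toMonoidHom) (by
    rintro _ ⟨u, rfl⟩
    refine ⟨Units.map (Subalgebra.inclusion (sInt_mono h)).toRingHom.toMonoidHom u, ?_⟩
    ext1
    ext <;> simp [quatIncl, QuaternionAlgebra.algebraMap_eq])

/-! ### The constants `𝔽_q[Z]` and the elements `d`, `s`, `[1 + αF]` -/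

/-- The quadratic extension `𝔽_q[Z] = 𝔽_q ⊕ 𝔽_q Z`, `Z² = c`, of the field of constants; its norm
is `QuadraticAlgebra.norm`, that is `u + vZ ↦ u² - c v²`. -/
abbrev Const {F : Type*} [Field F] (c : F) : Type _ := QuadraticAlgebra F c 0

/-- The embedding of `𝔽_q[Z]` in the quaternion order. -/
def const {F : Type*} [Field F] (c : F) (S₀ : Set F) : Const c →+* Quat c S₀ where
  toFun z := ⟨poly S₀ (C z.re), poly S₀ (C z.im), 0, 0⟩
  map_one' := by ext <;> simp [QuadraticAlgebra.re_one, QuadraticAlgebra.im_one]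
  map_zero' := by ext <;> simp
  map_add' x y := by ext <;> simp
  map_mul' x y := by ext <;> simp

/-- The element `F` of the quaternion order. -/
def quatF {F : Type*} [Field F] (c : F) (S₀ : Set F) : Quat c S₀ := ⟨0, 0, 1, 0⟩

lemma isUnit_poly {F : Type*} [Field F] {S₀ : Set F} {p : F[X]} (hp : p ≠ 0)
    (h : ∀ v : HeightOneSpectrum F[X], p ∈ v.asIdeal → v ∈ places S₀) : IsUnit (poly S₀ p) := by
  have hp' : algebraMap F[X] (RatFunc F) p ≠ 0 := by
    simpa using hp
  refine IsUnit.of_mul_eq_one ⟨(algebraMap F[X] (RatFunc F) p)⁻¹, fun v hv => ?_⟩ ?_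
  · have : v.valuation (RatFunc F) (algebraMap F[X] (RatFunc F) p) = 1 :=
      v.valuation_eq_one_iff_notMem.2 fun hv' => hv (h v hv')
    rw [map_inv₀, this, inv_one]
  · ext1
    exact mul_inv_cancel₀ hp'

lemma isUnit_t {F : Type*} [Field F] (S₀ : Set F) : IsUnit (poly S₀ X) :=
  isUnit_poly X_ne_zero fun _ hv => ⟨0, Set.mem_insert _ _, by simpa using hv⟩

lemma isUnit_one_sub {F : Type*} [Field F] (τ : Fˣ) :
    IsUnit (poly {(τ : F)} (1 - C ((τ⁻¹ : Fˣ) : F) * X)) := by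
  refine isUnit_poly (fun h => ?_) fun v hv => ⟨τ, by simp, ?_⟩
  · simpa using congrArg (eval 0) h
  · have h1 : (X - C (τ : F) : F[X]) = -C (τ : F) * (1 - C ((τ⁻¹ : Fˣ) : F) * X) := by
      have h2 : (C (τ : F) * C ((τ⁻¹ : Fˣ) : F) : F[X]) = 1 := by rw [← C_mul]; simp
      linear_combination (-X) * h2
    rw [h1]
    exact v.asIdeal.mul_mem_left _ hv

/-- `F` as a unit of the quaternion order. -/
def unitF {F : Type*} [Field F] (c : F) (S₀ : Set F) : (Quat c S₀)ˣ where
  val := quatF c S₀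
  inv := ⟨0, 0, ↑(isUnit_t S₀).unit⁻¹, 0⟩
  val_inv := by ext <;> simp [quatF]
  inv_val := by ext <;> simp [quatF]

lemma sq_const_mul_quatF {F : Type*} [Field F] {c : F} (S₀ : Set F) (α : Const c) :
    const c S₀ α * quatF c S₀ * (const c S₀ α * quatF c S₀) =
      algebraMap (SInt S₀) (Quat c S₀) (poly S₀ (C α.norm * X)) := by
  ext <;> simp [const, quatF, QuadraticAlgebra.norm_def, QuaternionAlgebra.algebraMap_eq] <;> ring

/-- `1 + αF` as a unit of the quaternion order with `S = {0, τ, ∞}`, for `N(α) = τ⁻¹`. -/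
def oneAdd {F : Type*} [Field F] {c : F} (τ : Fˣ) (α : Const c)
    (hα : α.norm = ((τ⁻¹ : Fˣ) : F)) : (Quat c {(τ : F)})ˣ where
  val := 1 + const c {(τ : F)} α * quatF c {(τ : F)}
  inv := (1 - const c {(τ : F)} α * quatF c {(τ : F)}) *
    algebraMap (SInt {(τ : F)}) (Quat c {(τ : F)}) ↑(isUnit_one_sub τ).unit⁻¹
  val_inv := by
    have h := sq_const_mul_quatF {(τ : F)} α
    set x := const c {(τ : F)} α * quatF c {(τ : F)}
    have h1 : (1 + x) * (1 - x) = algebraMap (SInt {(τ : F)}) (Quat c {(τ : F)})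
        (isUnit_one_sub τ).unit := by
      rw [IsUnit.unit_spec, map_sub, map_sub, ← hα, ← h, map_one, map_one]
      noncomm_ring
    rw [← mul_assoc, h1, ← map_mul, Units.mul_inv, map_one]
  inv_val := by
    have h := sq_const_mul_quatF {(τ : F)} α
    set x := const c {(τ : F)} α * quatF c {(τ : F)}
    have h1 : (1 - x) * (1 + x) = algebraMap (SInt {(τ : F)}) (Quat c {(τ : F)})
        (isUnit_one_sub τ).unit := by
      rw [IsUnit.unit_spec, map_sub, map_sub, ← hα, ← h, map_one, map_one]
      noncomm_ring
    rw [mul_assoc, Algebra.commutes, ← mul_assoc, h1, ← map_mul, Units.mul_inv, map_one]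

/-- The element `d = [δ]` of `Λ_S` for `δ ∈ 𝔽_q[Z]ˣ`. -/
def elD {F : Type*} [Field F] {c : F} (S₀ : Set F) (δ : (Const c)ˣ) : Lam c S₀ :=
  cls (Units.map (const c S₀).toMonoidHom δ)

/-- The element `s = [F]` of `Λ_S`. -/
def elS {F : Type*} [Field F] (c : F) (S₀ : Set F) : Lam c S₀ := cls (unitF c S₀)

/-- The element `[1 + αF]` of `Λ_τ`, for `N(α) = τ⁻¹`. -/
def elA {F : Type*} [Field F] {c : F} (τ : Fˣ) (α : Const c)
    (hα : α.norm = ((τ⁻¹ : Fˣ) : F)) : Lam c {(τ : F)} := cls (oneAdd τ α hα)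

/-- The set `PA_τ` of all `[1 + αF] ∈ Λ_τ` with `α ∈ 𝔽_q[Z]` and `N(α) = τ⁻¹`. -/
def PA {F : Type*} [Field F] (c : F) (τ : Fˣ) : Set (Lam c {(τ : F)}) :=
  {a | ∃ (α : Const c) (hα : α.norm = ((τ⁻¹ : Fˣ) : F)), a = elA τ α hα}

/-- The group `Γ_τ = ⟨PA_τ⟩ ⊆ Λ_τ`. -/
def Gam {F : Type*} [Field F] (c : F) (τ : Fˣ) : Subgroup (Lam c {(τ : F)}) :=
  Subgroup.closure (PA c τ)

/-- `α₀` is a constant defining `a_τ = [1 + α₀F]`: if `τ` is a square in `𝔽_q`, then `α₀ ∈ 𝔽_q` is a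
square root of `τ⁻¹`; otherwise `α₀ = α₁ δ⁻¹` with `α₁ ∈ 𝔽_q` a square root of
`δ^{q+1} τ⁻¹ = N(δ) τ⁻¹`. -/
def IsBase {F : Type*} [Field F] {c : F} (τ : Fˣ) (δ : (Const c)ˣ) (α₀ : Const c) : Prop :=
  (IsSquare (τ : F) ∧ ∃ x : F, x ^ 2 = ((τ⁻¹ : Fˣ) : F) ∧ α₀ = algebraMap F (Const c) x) ∨
  (¬ IsSquare (τ : F) ∧ ∃ x : F, x ^ 2 = (δ : Const c).norm * ((τ⁻¹ : Fˣ) : F) ∧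
    α₀ = algebraMap F (Const c) x * ((δ⁻¹ : (Const c)ˣ) : Const c))

lemma IsBase.norm_eq {F : Type*} [Field F] {c : F} {τ : Fˣ} {δ : (Const c)ˣ} {α₀ : Const c}
    (h : IsBase τ δ α₀) : α₀.norm = ((τ⁻¹ : Fˣ) : F) := by
  rcases h with ⟨-, x, hx, rfl⟩ | ⟨-, x, hx, rfl⟩
  · rw [QuadraticAlgebra.norm_algebraMap, hx]
  · rw [map_mul, QuadraticAlgebra.norm_algebraMap, hx, mul_right_comm, ← map_mul, Units.mul_inv,
      map_one, one_mul]

/-! ### Freeness on a symmetric set, and the presentation -/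

/-- `X` contains exactly one element of each pair `{a, a⁻¹}` with `a ∈ P`. -/
def IsHalf {G : Type*} [Group G] (P X : Set G) : Prop :=
  X ⊆ P ∧ ∀ a ∈ P, Xor (a ∈ X) (a⁻¹ ∈ X)

/-- Names of the three generators of the presentation. -/
inductive Gen : Type
  | d | s | a

/-- The relators of the presentation, for the generators `d`, `s`, `a`. -/
def relators (q : ℕ) (square : Prop) : Set (FreeGroup Gen) :=
  let d := FreeGroup.of Gen.d
  let s := FreeGroup.of Gen.s
  let a := FreeGroup.of Gen.a
  {d ^ (q + 1), s ^ 2, (s * d) ^ 2, (d ^ ((q + 1) / 2) * a) ^ 2} ∪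
    {r | square ∧ r = (s * a) * (a * s)⁻¹} ∪
    {r | ¬ square ∧ r = ((s * d) * a) * (a * (s * d))⁻¹}

end

end QuatLattice

open QuatLattice

open Polynomial IsDedekindDomain

namespace QuatLattice

noncomputable section

/-! ### Words in half of a symmetric set, dihedral groups, and an injectivity criterion -/

section GroupTheory

variable {G : Type*} [Group G]

/-! Write quaternions as A + BF with A, B over F[Z]; then Fα = ᾱF, and the reduced norm is N(A) - t
N(B), where N is anisotropic because `c` is a non-square.

Generation. Up to a scalar, a unit is a polynomial quaternion W whose norm divides a power of t(1 -
τ⁻¹t). If t divides the norm, F splits off on the right (`exists_eq_mul_quatF`); if the norm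
vanishes at τ, either the scalar 1 - τ⁻¹t or some 1 + αF with N(α) = τ⁻¹ splits off
(`exists_eq_mul_linear`); if the norm is constant, W is a constant. So the constants, F and `PA`
generate Λ_τ. The first two generate Λ_B and permute `PA` by conjugation, whence Γ_τ is normal and
Γ_τ Λ_B = Λ_τ.

Freeness. For a product of elements of `PA` without adjacent inverses, the residue at t = τ
satisfies A ≠ 0 and B = αĀ, with α taken from the first letter (`exists_rep_of_isChain`). Its norm
vanishes at τ but the product does not, which is impossible for an element of Λ_B
(`cls_notMem_range_lamIncl`). This single fact yields both freeness and Γ_τ ∩ Λ_B = 1.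

Presentation. By Hilbert 90, conjugation by d permutes `PA` simply transitively with period q + 1.
The relations suffice to show that, in the presented group, the conjugates of a are inverted and
permuted as in Λ_τ, so freeness downstairs gives injectivity (`injective_of_free_conjugates`). -/

lemma exists_isHalf {P : Set G} (hP : ∀ a ∈ P, a⁻¹ ∈ P ∧ a⁻¹ ≠ a) : ∃ X, IsHalf P X := by
  -- A well-order of the group selects the smaller element of each pair.
  refine ⟨{a ∈ P | WellOrderingRel a a⁻¹}, fun a ha => ha.1, fun a ha => ?_⟩
  simp only [Set.mem_ofPred_eq, inv_inv, ha, (hP a ha).1, true_and]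
  rcases trichotomous_of WellOrderingRel a a⁻¹ with h | h | h
  · exact Or.inl ⟨h, asymm h⟩
  · exact absurd h.symm (hP a ha).2
  · exact Or.inr ⟨h, asymm h⟩

lemma IsHalf.inv_notMem {P X : Set G} (h : IsHalf P X) {a : G} (ha : a ∈ X) : a⁻¹ ∉ X := by
  rcases h.2 a (h.1 ha) with h' | h'
  · exact h'.2
  · exact absurd ha h'.2

lemma IsHalf.mem_or_inv_mem {P X : Set G} (h : IsHalf P X) {a : G} (ha : a ∈ P) :
    a ∈ X ∨ a⁻¹ ∈ X :=
  (h.2 a ha).or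

lemma IsHalf.eq_union_inv {P X : Set G} (hP : ∀ a ∈ P, a⁻¹ ∈ P) (h : IsHalf P X) :
    P = X ∪ X⁻¹ := by
  ext a
  refine ⟨fun ha => h.mem_or_inv_mem ha, ?_⟩
  rintro (ha | ha)
  · exact h.1 ha
  · simpa using hP _ (h.1 ha)

lemma IsHalf.ncard_eq {P X : Set G} (hP : ∀ a ∈ P, a⁻¹ ∈ P) (hfin : P.Finite)
    (h : IsHalf P X) : P.ncard = 2 * X.ncard := by
  have hX : X.Finite := hfin.subset h.1
  rw [h.eq_union_inv hP, Set.ncard_union_eq _ hX hX.inv, ← Set.image_inv_eq_inv,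
    Set.ncard_image_of_injective _ inv_injective, two_mul]
  exact Set.disjoint_left.2 fun a ha ha' => h.inv_notMem ha ha'

lemma IsHalf.closure_eq {P X : Set G} (h : IsHalf P X) :
    (FreeGroup.lift (Subtype.val : X → G)).range = Subgroup.closure P := by
  rw [FreeGroup.range_lift_eq_closure, Subtype.range_coe]
  refine le_antisymm (Subgroup.closure_mono h.1) ((Subgroup.closure_le _).2 fun a ha => ?_)
  rcases h.mem_or_inv_mem ha with ha' | ha'
  · exact Subgroup.subset_closure ha'
  · simpa using (Subgroup.closure X).inv_mem (Subgroup.subset_closure ha')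

/-- If no nonempty product of elements of `P` without adjacent inverses lies in `H`, then a word
in a half of `P` whose value lies in `H` is trivial. -/
lemma IsHalf.eq_one_of_lift_mem {P X : Set G} (hP : ∀ a ∈ P, a⁻¹ ∈ P) (h : IsHalf P X)
    (H : Subgroup G)
    (hH : ∀ l : List G, l ≠ [] → (∀ a ∈ l, a ∈ P) → l.IsChain (fun a b => a * b ≠ 1) →
      l.prod ∉ H)
    {w : FreeGroup X} (hw : FreeGroup.lift (Subtype.val : X → G) w ∈ H) : w = 1 := by
  classical
  by_contra hw1
  have hred : FreeGroup.IsReduced w.toWord := FreeGroup.isReduced_toWord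
  have hval : FreeGroup.lift (Subtype.val : X → G) w =
      (w.toWord.map fun x => cond x.2 (x.1 : G) (x.1 : G)⁻¹).prod := by
    conv_lhs => rw [← FreeGroup.mk_toWord (x := w)]
    rw [FreeGroup.lift_mk]
  rw [hval] at hw
  refine hH _ ?_ ?_ ?_ hw
  · simpa using hw1
  · intro a ha
    obtain ⟨⟨x, b⟩, -, rfl⟩ := List.mem_map.1 ha
    cases b
    · exact hP _ (h.1 x.2)
    · exact h.1 x.2
  · rw [List.isChain_map]
    refine List.IsChain.imp ?_ hred
    rintro ⟨x, b⟩ ⟨y, b'⟩ hxy hmul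
    -- Letters of equal sign cannot cancel, since `X` never contains both members of a pair; letters
    -- of opposite sign cancel only if they coincide, which reducedness forbids.
    have key : ∀ z : X, (x : G) * z ≠ 1 := fun z hz =>
      h.inv_notMem x.2 (by rw [inv_eq_of_mul_eq_one_right hz]; exact z.2)
    cases b <;> cases b' <;> simp only [cond_true, cond_false] at hmul
    · rw [← mul_inv_rev, inv_eq_one] at hmul
      exact h.inv_notMem x.2 (by rw [inv_eq_of_mul_eq_one_left hmul]; exact y.2)
    · exact absurd (hxy (Subtype.ext (inv_mul_eq_one.1 hmul))) (by simp)
    · exact absurd (hxy (Subtype.ext (mul_inv_eq_one.1 hmul))) (by simp)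
    · exact key y hmul

lemma IsHalf.lift_injective {P X : Set G} (hP : ∀ a ∈ P, a⁻¹ ∈ P) (h : IsHalf P X)
    (H : Subgroup G)
    (hH : ∀ l : List G, l ≠ [] → (∀ a ∈ l, a ∈ P) → l.IsChain (fun a b => a * b ≠ 1) →
      l.prod ∉ H) : Function.Injective (FreeGroup.lift (Subtype.val : X → G)) :=
  (injective_iff_map_eq_one _).2 fun _ hw =>
    h.eq_one_of_lift_mem hP H hH (by rw [hw]; exact H.one_mem)

lemma disjoint_closure {P : Set G} (hP : ∀ a ∈ P, a⁻¹ ∈ P ∧ a⁻¹ ≠ a) (H : Subgroup G)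
    (hH : ∀ l : List G, l ≠ [] → (∀ a ∈ l, a ∈ P) → l.IsChain (fun a b => a * b ≠ 1) →
      l.prod ∉ H) : Disjoint (Subgroup.closure P) H := by
  obtain ⟨X, hX⟩ := exists_isHalf hP
  have hP' := fun a ha => (hP a ha).1
  rw [Subgroup.disjoint_def]
  intro x hx hxH
  rw [← hX.closure_eq] at hx
  obtain ⟨w, rfl⟩ := hx
  rw [hX.eq_one_of_lift_mem hP' H hH hxH, map_one]

/-- Both g and g⁻¹ are needed: conjugation by g alone might map an infinite group into a proper
subgroup of itself. -/
lemma mem_normalizer_closure {P : Set G} {g : G}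
    (h : ∀ x ∈ P, g * x * g⁻¹ ∈ Subgroup.closure P)
    (h' : ∀ x ∈ P, g⁻¹ * x * g⁻¹⁻¹ ∈ Subgroup.closure P) :
    g ∈ Subgroup.normalizer (Subgroup.closure P : Set G) := by
  have key : ∀ g : G, (∀ x ∈ P, g * x * g⁻¹ ∈ Subgroup.closure P) →
      ∀ x ∈ Subgroup.closure P, g * x * g⁻¹ ∈ Subgroup.closure P := fun g hg x hx =>
    (Subgroup.closure_le ((Subgroup.closure P).comap (MulAut.conj g).toMonoidHom)).2 hg hx
  refine Subgroup.mem_normalizer_iff.2 fun x => ⟨key g h x, fun hx => ?_⟩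
  simpa [mul_assoc] using key g⁻¹ h' _ hx

lemma zpow_mul_reflection {d s : G} (hs : s ^ 2 = 1) (hsd : (s * d) ^ 2 = 1) (i : ℤ) :
    d ^ i * s = s * d ^ (-i) := by
  have hs' : s⁻¹ = s := inv_eq_of_mul_eq_one_left (by rw [← sq, hs])
  have h1 : s * d * s⁻¹ = d⁻¹ := by
    rw [hs', eq_inv_iff_mul_eq_one, mul_assoc, ← sq, hsd]
  have h2 : s * d ^ (-i) * s⁻¹ = d ^ i := by rw [← conj_zpow, h1, inv_zpow', neg_neg]
  rw [← h2, inv_mul_cancel_right]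

/-- The elements of the subgroup generated by a rotation and a reflection. -/
lemma mem_closure_pair_dihedral {d s : G} (hs : s ^ 2 = 1) (hsd : (s * d) ^ 2 = 1) {x : G}
    (hx : x ∈ Subgroup.closure {d, s}) : ∃ i : ℤ, x = d ^ i ∨ x = s * d ^ i := by
  have hs' : s⁻¹ = s := inv_eq_of_mul_eq_one_left (by rw [← sq, hs])
  have hc := zpow_mul_reflection hs hsd
  induction hx using Subgroup.closure_induction'' with
  | mem x hx =>
    rcases hx with rfl | rfl
    · exact ⟨1, Or.inl (by simp)⟩
    · exact ⟨0, Or.inr (by simp)⟩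
  | inv_mem x hx =>
    rcases hx with rfl | rfl
    · exact ⟨-1, Or.inl (by simp)⟩
    · exact ⟨0, Or.inr (by simp [hs'])⟩
  | one => exact ⟨0, Or.inl (by simp)⟩
  | mul x y _ _ hx hy =>
    obtain ⟨i, rfl | rfl⟩ := hx <;> obtain ⟨j, rfl | rfl⟩ := hy
    · exact ⟨i + j, Or.inl (zpow_add ..).symm⟩
    · exact ⟨-i + j, Or.inr (by rw [← mul_assoc, hc, mul_assoc, ← zpow_add])⟩
    · exact ⟨i + j, Or.inr (by rw [mul_assoc, ← zpow_add])⟩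
    · refine ⟨-i + j, Or.inl ?_⟩
      rw [← mul_assoc, mul_assoc s, hc, ← mul_assoc, ← sq, hs, one_mul, ← zpow_add]

/-- A group generated by a rotation of order `n` and a reflection outside the rotations is
dihedral. -/
lemma exists_mulEquiv_dihedral {n : ℕ} [NeZero n] {d s : G} (hd : ∀ i : ℤ, d ^ i = 1 ↔ (n : ℤ) ∣ i)
    (hs : s ^ 2 = 1) (hsd : (s * d) ^ 2 = 1) (hne : ∀ i : ℤ, s * d ^ i ≠ 1)
    (hgen : Subgroup.closure {d, s} = ⊤) :
    ∃ e : G ≃* DihedralGroup n, e d = DihedralGroup.r 1 ∧ e s = DihedralGroup.sr 0 := by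
  have hc := zpow_mul_reflection hs hsd
  have hzeq : ∀ i j : ℤ, (i : ZMod n) = j → d ^ i = d ^ j := by
    intro i j hij
    rw [← mul_inv_eq_one, ← zpow_neg, ← zpow_add, hd, ← sub_eq_add_neg]
    exact (ZMod.intCast_eq_intCast_iff_dvd_sub _ _ _).1 hij.symm
  let r : ZMod n → G := fun i => d ^ (i.cast : ℤ)
  have hr : ∀ i : ℤ, d ^ i = r i := fun i => hzeq _ _ (by simp)
  have hradd : ∀ i j, r (i + j) = r i * r j := by
    intro i j
    simp only [r]
    rw [← zpow_add]
    exact hzeq _ _ (by simp)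
  have hrs : ∀ i, r i * s = s * r (-i) := by
    intro i
    simp only [r]
    rw [hc]
    congr 1
    exact hzeq _ _ (by simp)
  let f : DihedralGroup n →* G :=
    { toFun := fun x => match x with
        | .r i => r i
        | .sr i => s * r i
      map_one' := by
        change r 0 = 1
        simp [r]
      map_mul' := by
        rintro (i | i) (j | j)
        · exact hradd i j
        · change s * r (j - i) = r i * (s * r j)
          rw [← mul_assoc, hrs, mul_assoc, ← hradd, neg_add_eq_sub]
        · change s * r (i + j) = s * r i * r j
          rw [mul_assoc, ← hradd]
        · change r (j - i) = s * r i * (s * r j)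
          rw [← mul_assoc, mul_assoc s, hrs, ← mul_assoc, ← sq, hs, one_mul, ← hradd,
            neg_add_eq_sub] }
  have hf : Function.Bijective f := by
    constructor
    · rw [injective_iff_map_eq_one]
      rintro (i | i) h
      · change d ^ (i.cast : ℤ) = 1 at h
        rw [hd, ← ZMod.intCast_zmod_eq_zero_iff_dvd] at h
        simp only [ZMod.intCast_cast, ZMod.cast_id', id] at h
        rw [h]; rfl
      · exact absurd h (hne _)
    · rw [← MonoidHom.range_eq_top, eq_top_iff, ← hgen, Subgroup.closure_le]
      rintro _ (rfl | rfl)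
      · refine ⟨.r 1, ?_⟩
        change r 1 = _
        simpa using (hr 1).symm
      · refine ⟨.sr 0, ?_⟩
        change _ * r 0 = _
        simp [r]
  refine ⟨(MulEquiv.ofBijective f hf).symm, ?_, ?_⟩
  · rw [MulEquiv.symm_apply_eq]
    change d = r 1
    simpa using hr 1
  · rw [MulEquiv.symm_apply_eq]
    change s = s * r 0
    simp [r]

/-- Injectivity of a homomorphism on a group generated by a rotation `d`, a reflection `s` and a
further element `a`, in terms of the conjugates `dⁱ a d⁻ⁱ`: their images are, up to inversion,
the free generators of a group that meets the dihedral group trivially. -/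
lemma injective_of_free_conjugates {A : Type*} [Group A] (φ : A →* G) {d s a : A} {n m : ℕ}
    (hnm : n = m + m) {k : ℤ} (hd : d ^ n = 1) (hs : s ^ 2 = 1) (hsd : (s * d) ^ 2 = 1)
    (hda : (d ^ m * a) ^ 2 = 1) (hsa : s * a * s⁻¹ = d ^ k * a * d ^ (-k))
    (hgen : Subgroup.closure {d, s, a} = ⊤)
    (hφd : ∀ i : ℤ, φ d ^ i = 1 → (n : ℤ) ∣ i) (hφs : ∀ i : ℤ, φ s * φ d ^ i ≠ 1)
    (hφa : ∀ i j : ℤ, φ d ^ i * φ a * φ d ^ (-i) = φ d ^ j * φ a * φ d ^ (-j) → (n : ℤ) ∣ i - j)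
    {P X : Set G} (hP : ∀ x, x ∈ P ↔ ∃ i : ℤ, x = φ d ^ i * φ a * φ d ^ (-i))
    (hX : IsHalf P X) (hfree : Function.Injective (FreeGroup.lift (Subtype.val : X → G)))
    (hdisj : Disjoint (Subgroup.closure P) (Subgroup.closure {φ d, φ s})) :
    Function.Injective φ := by
  let b : ℤ → A := fun i => d ^ i * a * d ^ (-i)
  have hφb : ∀ i, φ (b i) = φ d ^ i * φ a * φ d ^ (-i) := fun i => by simp [b]
  have hdn : ∀ i : ℤ, (n : ℤ) ∣ i → d ^ i = 1 := by
    rintro _ ⟨j, rfl⟩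
    rw [zpow_mul, zpow_natCast, hd, one_zpow]
  -- Equal images force i ≡ j mod n, and dⁿ = 1 already holds in `A`: no two distinct conjugates are
  -- identified by φ.
  have hbeq : ∀ i j, φ (b i) = φ (b j) → b i = b j := by
    intro i j hij
    rw [hφb, hφb] at hij
    have h1 : d ^ i = d ^ j := by
      have := hdn _ (hφa i j hij)
      rwa [zpow_sub, mul_inv_eq_one] at this
    simp only [b, zpow_neg, h1]
  have hbd : ∀ i j : ℤ, d ^ j * b i * (d ^ j)⁻¹ = b (j + i) := by
    intro i j
    simp only [b, zpow_add, zpow_neg, mul_inv_rev, mul_assoc]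
  have hs' : s⁻¹ = s := inv_eq_of_mul_eq_one_left (by rw [← sq, hs])
  have hbs : ∀ i : ℤ, s * b i * s⁻¹ = b (k - i) := by
    intro i
    have h1 : s * d ^ i = d ^ (-i) * s := by
      rw [zpow_mul_reflection hs hsd, neg_neg]
    have h2 : d ^ (-i) * s⁻¹ = s⁻¹ * d ^ i := by
      rw [hs', zpow_mul_reflection hs hsd, neg_neg]
    calc s * b i * s⁻¹ = (s * d ^ i) * a * (d ^ (-i) * s⁻¹) := by simp only [b, mul_assoc]
      _ = d ^ (-i) * (s * a * s⁻¹) * d ^ i := by rw [h1, h2]; simp only [mul_assoc]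
      _ = b (k - i) := by
        rw [hsa]
        simp only [b, ← mul_assoc, ← zpow_add]
        rw [mul_assoc _ (d ^ (-k)), ← zpow_add]
        congr 3 <;> ring
  -- The relation (dᵐa)² = 1 reads a⁻¹ = dᵐ a dᵐ, and dᵐ = d⁻ᵐ because n = 2m.
  have hbinv : ∀ i, (b i)⁻¹ = b (i + m) := by
    intro i
    have h1 : a⁻¹ = d ^ (m : ℤ) * a * d ^ (-(m : ℤ)) := by
      have h2 : d ^ (-(m : ℤ)) = d ^ m := by
        have := hdn (m + m) (by simp [hnm])
        rw [zpow_neg, inv_eq_iff_mul_eq_one, ← this, zpow_add, zpow_natCast]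
      rw [h2, zpow_natCast, inv_eq_iff_mul_eq_one]
      rw [mul_eq_one_comm, mul_assoc, ← sq, hda]
    simp only [b, mul_inv_rev, h1, zpow_neg, inv_inv, zpow_add, mul_assoc]
  let N : Subgroup A := Subgroup.closure (Set.range b)
  have hbN : ∀ i, b i ∈ N := fun i => Subgroup.subset_closure ⟨i, rfl⟩
  have haN : a ∈ N := by simpa [b] using hbN 0
  have hN : N.Normal := by
    rw [← Subgroup.normalizer_eq_top_iff, eq_top_iff, ← hgen, Subgroup.closure_le]
    have hmem : ∀ g : A, (∀ i, g * b i * g⁻¹ ∈ N) → (∀ i, g⁻¹ * b i * g⁻¹⁻¹ ∈ N) →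
        g ∈ Subgroup.normalizer (N : Set A) := fun g h1 h2 =>
      mem_normalizer_closure (Set.forall_mem_range.2 h1) (Set.forall_mem_range.2 h2)
    rintro _ (rfl | rfl | rfl)
    · refine hmem _ (fun i => ?_) fun i => ?_
      · have := hbd i 1
        rw [zpow_one] at this
        rw [this]; exact hbN _
      · have := hbd i (-1)
        rw [zpow_neg_one] at this
        rw [this]; exact hbN _
    · refine hmem _ (fun i => ?_) fun i => ?_
      · rw [hbs]; exact hbN _
      · rw [hs', hbs]; exact hbN _
    · exact Subgroup.le_normalizer haN
  have hbX : ∀ x : X, ∃ i, φ (b i) = x := fun x => by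
    obtain ⟨i, hi⟩ := (hP x).1 (hX.1 x.2)
    exact ⟨i, by rw [hφb, hi]⟩
  choose ι hι using hbX
  -- Lifting each free generator to a conjugate of a gives a map whose composite with φ is the
  -- injective evaluation map. Its image contains all of `N`, so φ is injective on `N`.
  let f : FreeGroup X →* A := FreeGroup.lift fun x => b (ι x)
  have hφf : ∀ w, φ (f w) = FreeGroup.lift (Subtype.val : X → G) w := by
    intro w
    rw [← MonoidHom.comp_apply]
    refine FreeGroup.lift_unique (f := (Subtype.val : X → G)) (φ.comp f) fun x => ?_
    simp [f, hι]
  have hNf : N ≤ f.range := by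
    rw [Subgroup.closure_le]
    rintro _ ⟨i, rfl⟩
    have hmem : φ (b i) ∈ P := (hP _).2 ⟨i, hφb i⟩
    rcases hX.mem_or_inv_mem hmem with h | h
    · refine ⟨FreeGroup.of ⟨_, h⟩, ?_⟩
      simp only [f, FreeGroup.lift_apply_of]
      exact hbeq _ _ (hι _)
    · refine ⟨(FreeGroup.of ⟨_, h⟩)⁻¹, ?_⟩
      simp only [f, FreeGroup.lift_apply_of, map_inv]
      rw [inv_eq_iff_eq_inv, hbinv]
      refine hbeq _ _ ((hι _).trans ?_)
      rw [← hbinv, map_inv]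
  have htop : ∀ x : A, ∃ y ∈ N, ∃ z ∈ Subgroup.closure {d, s}, y * z = x := by
    intro x
    rw [← Subgroup.mem_sup_of_normal_left (s := N)]
    have : (⊤ : Subgroup A) ≤ N ⊔ Subgroup.closure {d, s} := by
      rw [← hgen, Subgroup.closure_le]
      rintro _ (rfl | rfl | rfl)
      · exact Subgroup.mem_sup_right (Subgroup.subset_closure (by simp))
      · exact Subgroup.mem_sup_right (Subgroup.subset_closure (by simp))
      · exact Subgroup.mem_sup_left haN
    exact this (Subgroup.mem_top x)
  rw [injective_iff_map_eq_one]
  intro x hx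
  obtain ⟨y, hy, z, hz, rfl⟩ := htop x
  have hyP : φ y ∈ Subgroup.closure P := by
    have : N ≤ (Subgroup.closure P).comap φ := by
      rw [Subgroup.closure_le]
      rintro _ ⟨i, rfl⟩
      exact Subgroup.subset_closure ((hP _).2 ⟨i, hφb i⟩)
    exact this hy
  have hzH : φ z ∈ Subgroup.closure {φ d, φ s} := by
    have : Subgroup.closure {d, s} ≤ (Subgroup.closure {φ d, φ s}).comap φ := by
      rw [Subgroup.closure_le]
      rintro _ (rfl | rfl) <;> exact Subgroup.subset_closure (by simp)
    exact this hz
  rw [map_mul] at hx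
  -- φ y = (φ z)⁻¹ lies in both factors. Freeness then kills y, and the order of φ d together with
  -- `hφs` kills z.
  have hy1 : φ y = 1 := Subgroup.disjoint_def.1 hdisj hyP (by
    rw [eq_inv_of_mul_eq_one_left hx]
    exact Subgroup.inv_mem _ hzH)
  have hz1 : φ z = 1 := by simpa [hy1] using hx
  obtain ⟨w, rfl⟩ := hNf hy
  rw [hφf] at hy1
  rw [(injective_iff_map_eq_one _).1 hfree w hy1, map_one, one_mul]
  obtain ⟨i, rfl | rfl⟩ := mem_closure_pair_dihedral hs hsd hz
  · exact hdn i (hφd i (by simpa using hz1))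
  · exact absurd (by simpa using hz1) (hφs i)

end GroupTheory

/-! ### Denominators of S-integers -/

section Denominators

variable {F : Type*} [Field F] {S₀ : Set F}

lemma coe_poly (p : F[X]) : ((poly S₀ p : SInt S₀) : RatFunc F) = algebraMap F[X] (RatFunc F) p :=
  rfl

lemma poly_injective : Function.Injective (poly S₀) := fun p q h => by
  have := congrArg (Subtype.val) h
  exact IsFractionRing.injective F[X] (RatFunc F) this

/-- Each prime factor of `a`, counted with multiplicity, costs one power of `g`. -/
lemma dvd_pow_of_irreducible_dvd {g : F[X]} (a : F[X]) (ha : a ≠ 0)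
    (h : ∀ p, Irreducible p → p ∣ a → p ∣ g) : ∃ N, a ∣ g ^ N := by
  induction a using UniqueFactorizationMonoid.induction_on_prime with
  | h₁ => exact absurd rfl ha
  | h₂ x hx => exact ⟨0, hx.dvd⟩
  | h₃ a p ha0 hp ih =>
    obtain ⟨N, hN⟩ := ih ha0 fun r hr hra => h r hr (hra.mul_left p)
    refine ⟨N + 1, ?_⟩
    rw [pow_succ']
    exact mul_dvd_mul (h p hp.irreducible (dvd_mul_right p a)) hN

/-- The denominator of an `S`-integer divides a power of any `g` that vanishes on `S`. -/
lemma exists_pow_mul_eq_poly {g : F[X]} (hg : ∀ v ∈ places S₀, g ∈ v.asIdeal) (x : SInt S₀) :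
    ∃ (N : ℕ) (p : F[X]), poly S₀ (g ^ N) * x = poly S₀ p := by
  obtain ⟨N, r, hr⟩ := dvd_pow_of_irreducible_dvd (g := g) (x : RatFunc F).denom
    (RatFunc.denom_ne_zero _) (by
      intro p hp hpd
      let v : HeightOneSpectrum F[X] :=
        ⟨Ideal.span {p}, (Ideal.span_singleton_prime hp.ne_zero).2 hp.prime, by
          simpa using hp.ne_zero⟩
      have hv : v ∈ places S₀ := by
        -- At a place outside `S` the equation x · denom = num would give the numerator valuation
        -- less than 1, against coprimality with the denominator.
        by_contra hv
        have h1 : v.valuation (RatFunc F) (x : RatFunc F) ≤ 1 := x.2 v hv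
        have hd : (x : RatFunc F).denom ∈ v.asIdeal := Ideal.mem_span_singleton.2 hpd
        have hn : (x : RatFunc F).num ∉ v.asIdeal := fun hn =>
          hp.not_isUnit ((RatFunc.isCoprime_num_denom (x : RatFunc F)).isUnit_of_dvd'
            (Ideal.mem_span_singleton.1 hn) hpd)
        have h2 := (v.valuation_lt_one_iff_mem (K := RatFunc F) _).2 hd
        have h3 := (v.valuation_eq_one_iff_notMem (K := RatFunc F)).2 hn
        have h4 : (x : RatFunc F) * algebraMap F[X] (RatFunc F) (x : RatFunc F).denom =
            algebraMap F[X] (RatFunc F) (x : RatFunc F).num := by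
          conv_lhs => enter [1]; rw [← RatFunc.num_div_denom (x : RatFunc F)]
          exact div_mul_cancel₀ _ (by simpa using RatFunc.denom_ne_zero (x : RatFunc F))
        have h5 := congrArg (v.valuation (RatFunc F)) h4
        rw [map_mul, h3] at h5
        exact absurd h5 (mul_lt_one_of_nonneg_of_lt_one_right h1 zero_le h2).ne
      exact Ideal.mem_span_singleton.1 (hg v hv))
  refine ⟨N, r * (x : RatFunc F).num, ?_⟩
  ext1
  simp only [MulMemClass.coe_mul, coe_poly, hr, map_mul]
  conv_lhs => enter [2]; rw [← RatFunc.num_div_denom (x : RatFunc F)]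
  have : algebraMap F[X] (RatFunc F) (x : RatFunc F).denom ≠ 0 := by
    simpa using RatFunc.denom_ne_zero (x : RatFunc F)
  field_simp

end Denominators

/-! ### The quaternion order over F[t] and its reduced norm -/

section PolyQuat

variable {F : Type*} [Field F] {c : F}

/-- The quaternion order over `F[t]`. -/
abbrev PolyQuat (c : F) : Type _ := QuaternionAlgebra F[X] (C c) 0 X

/-- The reduced norm on the order over `F[t]`. -/
def nrd : PolyQuat c →* F[X] where
  toFun w := w.re ^ 2 - C c * w.imI ^ 2 - X * (w.imJ ^ 2 - C c * w.imK ^ 2)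
  map_one' := by simp
  map_mul' v w := by simp; ring

lemma nrd_def (w : PolyQuat c) :
    nrd w = w.re ^ 2 - C c * w.imI ^ 2 - X * (w.imJ ^ 2 - C c * w.imK ^ 2) := rfl

/-- The inclusion of the order over `F[t]` in the order over the `S`-integers. -/
def toQuat (c : F) (S₀ : Set F) : PolyQuat c →+* Quat c S₀ where
  toFun w := ⟨poly S₀ w.re, poly S₀ w.imI, poly S₀ w.imJ, poly S₀ w.imK⟩
  map_one' := by ext <;> simp
  map_zero' := by ext <;> simp
  map_add' x y := by ext <;> simp
  map_mul' x y := by ext <;> simp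

lemma toQuat_injective (S₀ : Set F) : Function.Injective (toQuat c S₀) := by
  intro v w h
  ext1
  · exact poly_injective (congrArg QuaternionAlgebra.re h)
  · exact poly_injective (congrArg QuaternionAlgebra.imI h)
  · exact poly_injective (congrArg QuaternionAlgebra.imJ h)
  · exact poly_injective (congrArg QuaternionAlgebra.imK h)

lemma toQuat_coe (S₀ : Set F) (p : F[X]) :
    toQuat c S₀ (p : PolyQuat c) = algebraMap (SInt S₀) (Quat c S₀) (poly S₀ p) := by
  ext <;> simp [toQuat, QuaternionAlgebra.algebraMap_eq]

lemma nrd_coe (p : F[X]) : nrd (p : PolyQuat c) = p ^ 2 := by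
  simp [nrd_def]

/-- Every element of the order over the `S`-integers becomes polynomial after multiplication by a
power of a polynomial that vanishes on `S`. -/
lemma exists_pow_mul_eq_toQuat {S₀ : Set F} {g : F[X]} (hg : ∀ v ∈ places S₀, g ∈ v.asIdeal)
    (x : Quat c S₀) :
    ∃ (N : ℕ) (W : PolyQuat c), toQuat c S₀ ((g ^ N : F[X]) : PolyQuat c) * x = toQuat c S₀ W := by
  obtain ⟨N₁, p₁, h₁⟩ := exists_pow_mul_eq_poly hg x.re
  obtain ⟨N₂, p₂, h₂⟩ := exists_pow_mul_eq_poly hg x.imI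
  obtain ⟨N₃, p₃, h₃⟩ := exists_pow_mul_eq_poly hg x.imJ
  obtain ⟨N₄, p₄, h₄⟩ := exists_pow_mul_eq_poly hg x.imK
  refine ⟨N₁ + N₂ + N₃ + N₄, ⟨g ^ (N₂ + N₃ + N₄) * p₁, g ^ (N₁ + N₃ + N₄) * p₂,
    g ^ (N₁ + N₂ + N₄) * p₃, g ^ (N₁ + N₂ + N₃) * p₄⟩, ?_⟩
  rw [toQuat_coe, ← Algebra.smul_def]
  ext1 <;> simp only [toQuat, RingHom.coe_mk, MonoidHom.coe_mk, OneHom.coe_mk, map_mul, ← h₁, ← h₂,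
    ← h₃, ← h₄, QuaternionAlgebra.re_smul, QuaternionAlgebra.imI_smul, QuaternionAlgebra.imJ_smul,
    QuaternionAlgebra.imK_smul, smul_eq_mul, pow_add] <;> ring

/-- A unit of the order over the `S`-integers is polynomial up to a power of `g`, with a reduced
norm dividing a power of `g`. -/
lemma exists_toQuat_of_unit {S₀ : Set F} {g : F[X]} (hg : ∀ v ∈ places S₀, g ∈ v.asIdeal)
    (u : (Quat c S₀)ˣ) :
    ∃ (N : ℕ) (W : PolyQuat c), toQuat c S₀ ((g ^ N : F[X]) : PolyQuat c) * u = toQuat c S₀ W ∧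
      ∃ M, nrd W ∣ g ^ M := by
  obtain ⟨N, W, hW⟩ := exists_pow_mul_eq_toQuat hg (u : Quat c S₀)
  obtain ⟨N', W', hW'⟩ := exists_pow_mul_eq_toQuat hg ((u⁻¹ : (Quat c S₀)ˣ) : Quat c S₀)
  refine ⟨N, W, hW, 2 * (N + N'), ?_⟩
  -- Clearing denominators in u and in u⁻¹ gives two elements with product a power of g;
  -- multiplicativity of the norm does the rest.
  have h : W * W' = ((g ^ (N + N') : F[X]) : PolyQuat c) := by
    apply toQuat_injective S₀
    rw [map_mul, ← hW, ← hW', toQuat_coe, toQuat_coe, toQuat_coe, Algebra.commutes _ (u⁻¹).val,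
      mul_assoc, ← mul_assoc u.val, Units.mul_inv, one_mul, ← map_mul, ← map_mul, pow_add]
  have := congrArg nrd h
  rw [map_mul, nrd_coe, ← pow_mul'] at this
  rw [← this]
  exact dvd_mul_right _ _

end PolyQuat

/-! ### Equality of classes modulo scalars -/

section Classes

variable {F : Type*} [Field F] {c : F} {S₀ : Set F}

lemma cls_eq_cls_iff {u v : (Quat c S₀)ˣ} :
    cls u = cls v ↔ ∃ r : (SInt S₀)ˣ, (v : Quat c S₀) = algebraMap (SInt S₀) (Quat c S₀) r * u := by
  rw [QuotientGroup.eq]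
  constructor
  · rintro ⟨r, hr⟩
    refine ⟨r, ?_⟩
    rw [Algebra.commutes, ← mul_inv_cancel_left u v, ← hr]
    rfl
  · rintro ⟨r, hr⟩
    refine ⟨r, ?_⟩
    rw [eq_inv_mul_iff_mul_eq]
    ext1
    rw [hr, Algebra.commutes]
    rfl

lemma cls_eq_one_iff {u : (Quat c S₀)ˣ} :
    cls u = 1 ↔ ∃ r : (SInt S₀)ˣ, (u : Quat c S₀) = algebraMap (SInt S₀) (Quat c S₀) r := by
  rw [eq_comm]
  exact (cls_eq_cls_iff (u := 1)).trans (by simp)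

end Classes

/-! ### Residues at t = τ, right factors, and elements of constant norm -/

section Evaluation

variable {F : Type*} [Field F] {c : F}

/-- The value at `t = τ` of the coefficient `A` of `A + BF`. -/
def constPart (τ : F) (W : PolyQuat c) : Const c := ⟨W.re.eval τ, W.imI.eval τ⟩

/-- The value at `t = τ` of the coefficient `B` of `A + BF`. -/
def fPart (τ : F) (W : PolyQuat c) : Const c := ⟨W.imJ.eval τ, W.imK.eval τ⟩

lemma eval_nrd (τ : F) (W : PolyQuat c) :
    (nrd W).eval τ = (constPart τ W).norm - τ * (fPart τ W).norm := by
  simp [nrd_def, constPart, fPart, QuadraticAlgebra.norm_def]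
  ring

/-- Moving F past a constant conjugates it, and F² = t takes the value τ. -/
lemma constPart_mul (τ : F) (V W : PolyQuat c) : constPart τ (V * W) =
    constPart τ V * constPart τ W + algebraMap F (Const c) τ * (fPart τ V * star (fPart τ W)) := by
  ext <;> simp [constPart, fPart] <;> ring

lemma fPart_mul (τ : F) (V W : PolyQuat c) : fPart τ (V * W) =
    constPart τ V * fPart τ W + fPart τ V * star (constPart τ W) := by
  ext <;> simp [constPart, fPart] <;> ring

/-- `α + βF` as an element of the order over `F[t]`. -/
def linear (α β : Const c) : PolyQuat c := ⟨C α.re, C α.im, C β.re, C β.im⟩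

lemma constPart_linear (τ : F) (α β : Const c) : constPart τ (linear α β) = α := by
  simp [constPart, linear]

lemma fPart_linear (τ : F) (α β : Const c) : fPart τ (linear α β) = β := by
  simp [fPart, linear]

lemma nrd_linear (α β : Const c) : nrd (linear α β) = C α.norm - X * C β.norm := by
  simp [nrd_def, linear, QuadraticAlgebra.norm_def]
  ring

lemma toQuat_linear_zero (S₀ : Set F) (α : Const c) :
    toQuat c S₀ (linear α 0) = const c S₀ α := by
  ext <;> simp [toQuat, linear, const]

lemma toQuat_quatF (S₀ : Set F) :
    toQuat c S₀ (linear 0 1) = quatF c S₀ := by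
  ext <;> simp [toQuat, linear, quatF, QuadraticAlgebra.re_one, QuadraticAlgebra.im_one]

lemma toQuat_linear_one (S₀ : Set F) (α : Const c) :
    toQuat c S₀ (linear 1 α) = 1 + const c S₀ α * quatF c S₀ := by
  ext <;> simp [toQuat, linear, const, quatF, QuadraticAlgebra.re_one, QuadraticAlgebra.im_one]

lemma linear_mul_linear_neg (α : Const c) :
    linear 1 (-α) * linear 1 α = ((1 - C α.norm * X : F[X]) : PolyQuat c) := by
  ext1 <;> simp [linear, QuadraticAlgebra.norm_def, QuadraticAlgebra.re_one,
    QuadraticAlgebra.im_one] <;> ring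

lemma linear_mul_linear (α β : Const c) : linear α 0 * linear 1 β = linear α (α * β) := by
  ext1 <;> simp [linear, QuadraticAlgebra.re_one, QuadraticAlgebra.im_one]

lemma norm_eq_zero_iff (hc : ¬ IsSquare c) {z : Const c} : z.norm = 0 ↔ z = 0 := by
  have : Fact (∀ r : F, r ^ 2 ≠ c + 0 * r) :=
    ⟨fun r hr => hc ⟨r, by rw [← sq, hr]; ring⟩⟩
  exact QuadraticAlgebra.norm_eq_zero_iff_eq_zero

lemma exists_mul_eq_one (hc : ¬ IsSquare c) {z : Const c} (hz : z ≠ 0) : ∃ w, z * w = 1 := by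
  have h : IsUnit z := QuadraticAlgebra.isUnit_iff_norm_isUnit.2
    (isUnit_iff_ne_zero.2 (mt (norm_eq_zero_iff hc).1 hz))
  exact h.exists_right_inv

lemma exists_eq_mul_quatF (hc : ¬ IsSquare c) {W : PolyQuat c} (h : X ∣ nrd W) : ∃ W', W = W' * linear 0 1 := by
  have h0 : (nrd W).eval 0 = 0 := eval_eq_zero_of_dvd_of_eval_eq_zero h (by simp)
  rw [eval_nrd, zero_mul, sub_zero, norm_eq_zero_iff hc] at h0
  obtain ⟨p, hp⟩ : X ∣ W.re := by
    rw [X_dvd_iff, coeff_zero_eq_eval_zero]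
    exact congrArg QuadraticAlgebra.re h0
  obtain ⟨r, hr⟩ : X ∣ W.imI := by
    rw [X_dvd_iff, coeff_zero_eq_eval_zero]
    exact congrArg QuadraticAlgebra.im h0
  -- With A = tA' = A'F² one has A + BF = (B + A'F)F.
  refine ⟨⟨W.imJ, W.imK, p, r⟩, ?_⟩
  ext1 <;> simp [linear, QuadraticAlgebra.re_one, QuadraticAlgebra.im_one, hp, hr]

lemma exists_eq_mul_of_parts_eq_zero {τ : F} (hτ : τ ≠ 0) {W : PolyQuat c}
    (hA : constPart τ W = 0) (hB : fPart τ W = 0) :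
    ∃ W', W = W' * ((1 - C τ⁻¹ * X : F[X]) : PolyQuat c) := by
  have hdvd : ∀ p : F[X], p.eval τ = 0 → ∃ r, p = r * (1 - C τ⁻¹ * X) := by
    intro p hp
    obtain ⟨r, hr⟩ := dvd_iff_isRoot.2 hp
    -- The factor comes from X - τ = -τ(1 - τ⁻¹X).
    refine ⟨-C τ * r, ?_⟩
    have h2 : (C τ * C τ⁻¹ : F[X]) = 1 := by rw [← C_mul, mul_inv_cancel₀ hτ, C_1]
    rw [hr]
    linear_combination (-X * r) * h2
  obtain ⟨p₁, h₁⟩ := hdvd _ (congrArg QuadraticAlgebra.re hA)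
  obtain ⟨p₂, h₂⟩ := hdvd _ (congrArg QuadraticAlgebra.im hA)
  obtain ⟨p₃, h₃⟩ := hdvd _ (congrArg QuadraticAlgebra.re hB)
  obtain ⟨p₄, h₄⟩ := hdvd _ (congrArg QuadraticAlgebra.im hB)
  refine ⟨⟨p₁, p₂, p₃, p₄⟩, ?_⟩
  ext1 <;> simp [h₁, h₂, h₃, h₄]

/-- At τ one has N(A) = τN(B). If A = 0 there, then B = 0 by anisotropy and the scalar splits off.
Otherwise α = A⁻¹B has norm τ⁻¹ and W ≡ A(1 + αF) modulo t - τ; the error is a multiple of 1 - τ⁻¹t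
= (1 - αF)(1 + αF), hence also has 1 + αF as a right factor. -/
lemma exists_eq_mul_linear (hc : ¬ IsSquare c) {τ : F} (hτ : τ ≠ 0) {W : PolyQuat c} (h : (nrd W).eval τ = 0) :
    (∃ W', W = W' * ((1 - C τ⁻¹ * X : F[X]) : PolyQuat c)) ∨
      ∃ (α : Const c) (W' : PolyQuat c), α.norm = τ⁻¹ ∧ W = W' * linear 1 α := by
  rw [eval_nrd, sub_eq_zero] at h
  by_cases hA : constPart τ W = 0
  · left
    refine exists_eq_mul_of_parts_eq_zero hτ hA ?_
    rw [hA, QuadraticAlgebra.norm_zero, eq_comm, mul_eq_zero, norm_eq_zero_iff hc] at h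
    exact h.resolve_left hτ
  · right
    obtain ⟨w, hw⟩ := exists_mul_eq_one hc hA
    have hN : (w * fPart τ W).norm = τ⁻¹ := by
      have h1 := congrArg QuadraticAlgebra.norm hw
      rw [map_mul, map_one, h] at h1
      rw [map_mul, ← mul_eq_one_iff_eq_inv₀ hτ, ← h1]
      ring
    obtain ⟨W', hW'⟩ := exists_eq_mul_of_parts_eq_zero hτ
      (W := W - linear (constPart τ W) 0 * linear 1 (w * fPart τ W))
      (by
        rw [linear_mul_linear]
        ext <;> simp [constPart, linear])
      (by
        rw [linear_mul_linear, ← mul_assoc, hw, one_mul]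
        ext <;> simp [fPart, linear])
    refine ⟨w * fPart τ W, linear (constPart τ W) 0 + W' * linear 1 (-(w * fPart τ W)), hN, ?_⟩
    rw [add_mul, mul_assoc, linear_mul_linear_neg, hN, ← hW', add_sub_cancel]

/-- The coefficient in degree 2n is the norm of the pair of degree-n coefficients, not both zero, so
anisotropy excludes cancellation. -/
lemma natDegree_sq_sub_C_mul_sq (hc : ¬ IsSquare c) {a b : F[X]}
    (h : ¬ (a = 0 ∧ b = 0)) : ∃ n, (a ^ 2 - C c * b ^ 2).natDegree = 2 * n ∧ a.natDegree ≤ n ∧ b.natDegree ≤ n ∧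
      a ^ 2 - C c * b ^ 2 ≠ 0 := by
  set n := max a.natDegree b.natDegree with hn
  have ha : a.natDegree ≤ n := le_max_left _ _
  have hb : b.natDegree ≤ n := le_max_right _ _
  have hcoeff : (a ^ 2 - C c * b ^ 2).coeff (2 * n) = (⟨a.coeff n, b.coeff n⟩ : Const c).norm := by
    rw [coeff_sub, coeff_C_mul, coeff_pow_of_natDegree_le ha, coeff_pow_of_natDegree_le hb,
      QuadraticAlgebra.norm_def]
    ring
  have hne : (a ^ 2 - C c * b ^ 2).coeff (2 * n) ≠ 0 := by
    rw [hcoeff, Ne, norm_eq_zero_iff hc]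
    intro h0
    have h1 : a.coeff n = 0 := congrArg QuadraticAlgebra.re h0
    have h2 : b.coeff n = 0 := congrArg QuadraticAlgebra.im h0
    rcases le_total a.natDegree b.natDegree with hab | hab
    · have hb0 : b = 0 := by rw [← leadingCoeff_eq_zero, leadingCoeff, ← h2, hn, max_eq_right hab]
      refine h ⟨?_, hb0⟩
      rw [hb0, natDegree_zero, nonpos_iff_eq_zero] at hab
      rw [← leadingCoeff_eq_zero, leadingCoeff, ← h1, hn, hb0, hab, natDegree_zero, max_self]
    · have ha0 : a = 0 := by rw [← leadingCoeff_eq_zero, leadingCoeff, ← h1, hn, max_eq_left hab]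
      refine h ⟨ha0, ?_⟩
      rw [ha0, natDegree_zero, nonpos_iff_eq_zero] at hab
      rw [← leadingCoeff_eq_zero, leadingCoeff, ← h2, hn, ha0, hab, natDegree_zero, max_self]
  refine ⟨n, le_antisymm ?_ (le_natDegree_of_ne_zero hne), ha, hb, fun h0 => hne (by simp [h0])⟩
  refine (natDegree_sub_le _ _).trans (max_le ?_ ?_)
  · exact natDegree_pow_le_of_le 2 ha
  · exact (natDegree_C_mul_le _ _).trans (natDegree_pow_le_of_le 2 hb)

/-- An element of constant nonzero reduced norm is a constant. -/
lemma exists_eq_linear_zero (hc : ¬ IsSquare c) {W : PolyQuat c} (h0 : nrd W ≠ 0) (h : (nrd W).natDegree = 0) :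
    ∃ α : Const c, α ≠ 0 ∧ W = linear α 0 := by
  -- N(A) has even degree and t N(B) odd degree, so they cannot cancel; a constant norm leaves no
  -- room for B.
  have hJK : W.imJ = 0 ∧ W.imK = 0 := by
    by_contra hJK
    obtain ⟨m, hm, -, -, hm0⟩ := natDegree_sq_sub_C_mul_sq hc hJK
    have hX : (X * (W.imJ ^ 2 - C c * W.imK ^ 2)).natDegree = 2 * m + 1 := by
      rw [natDegree_X_mul hm0, hm]
    by_cases hRI : W.re = 0 ∧ W.imI = 0
    · rw [nrd_def, hRI.1, hRI.2] at h
      simp [hX] at h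
    · obtain ⟨n, hn, -⟩ := natDegree_sq_sub_C_mul_sq hc hRI
      rw [nrd_def] at h
      rcases lt_or_ge m n with hmn | hmn
      · rw [natDegree_sub_eq_left_of_natDegree_lt (by rw [hX, hn]; omega), hn] at h
        omega
      · rw [natDegree_sub_eq_right_of_natDegree_lt (by rw [hX, hn]; omega), hX] at h
        omega
  have hRI : ¬ (W.re = 0 ∧ W.imI = 0) := fun hRI => h0 (by simp [nrd_def, hRI, hJK])
  obtain ⟨n, hn, hr, hi, -⟩ := natDegree_sq_sub_C_mul_sq hc hRI
  have hn0 : n = 0 := by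
    rw [nrd_def, hJK.1, hJK.2] at h
    simp [hn] at h
    exact h
  rw [hn0, nonpos_iff_eq_zero] at hr hi
  have hW : W = linear ⟨W.re.coeff 0, W.imI.coeff 0⟩ 0 := by
    ext1
    · exact eq_C_of_natDegree_eq_zero hr
    · exact eq_C_of_natDegree_eq_zero hi
    · simp [linear, hJK]
    · simp [linear, hJK]
  refine ⟨_, fun hα => hRI ?_, hW⟩
  rw [hW, hα]
  simp [linear]

end Evaluation

/-! ### Generation of Λ_B and Λ_τ -/

section Generation

variable {F : Type*} [Field F] {c : F}

/-- A subgroup of `Λ_S` containing the constants is everything if, for every irreducible `p`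
supported on `S`, the polynomial elements with norm divisible by `p` have a right factor in it. -/
lemma eq_top_of_right_factors (hc : ¬ IsSquare c) {S₀ : Set F} {g : F[X]}
    (hg : ∀ v ∈ places S₀, g ∈ v.asIdeal) (hgu : IsUnit (poly S₀ g)) (hg0 : g ≠ 0)
    (T : Subgroup (Lam c S₀)) (hconst : ∀ δ : (Const c)ˣ, elD S₀ δ ∈ T)
    (hstep : ∀ (W : PolyQuat c) (p : F[X]), Irreducible p → p ∣ g → p ∣ nrd W →
      ∃ (W' V : PolyQuat c) (v : (Quat c S₀)ˣ), W = W' * V ∧ (nrd V).natDegree ≠ 0 ∧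
        (v : Quat c S₀) = toQuat c S₀ V ∧ cls v ∈ T) : T = ⊤ := by
  -- Induction on the degree of the norm. That the norm divides a power of `g` is carried along, so
  -- that its irreducible factors are among those of `g` and `hstep` applies.
  have key : ∀ (n : ℕ) (W : PolyQuat c) (u : (Quat c S₀)ˣ) (M : ℕ), (nrd W).natDegree = n →
      nrd W ∣ g ^ M → (u : Quat c S₀) = toQuat c S₀ W → cls u ∈ T := by
    intro n
    induction n using Nat.strong_induction_on with
    | _ n ih =>
      intro W u M hn hM hu
      have hW0 : nrd W ≠ 0 := fun h => pow_ne_zero M hg0 (zero_dvd_iff.1 (h ▸ hM))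
      by_cases hd : (nrd W).natDegree = 0
      · obtain ⟨α, hα, rfl⟩ := exists_eq_linear_zero hc hW0 hd
        obtain ⟨β, hβ⟩ := exists_mul_eq_one hc hα
        have : u = Units.map (const c S₀).toMonoidHom ⟨α, β, hβ, by rw [mul_comm, hβ]⟩ := by
          ext1
          rw [hu, toQuat_linear_zero]
          rfl
        rw [this]
        exact hconst _
      · obtain ⟨p, hp, hpW⟩ := exists_irreducible_of_natDegree_ne_zero hd
        obtain ⟨W', V, v, rfl, hV, hv, hvT⟩ :=
          hstep W p hp (hp.prime.dvd_of_dvd_pow (hpW.trans hM)) hpW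
        rw [map_mul] at hW0 hn hM
        have hu' : cls (u * v⁻¹) ∈ T := by
          refine ih (nrd W').natDegree ?_ W' (u * v⁻¹) M rfl (dvd_of_mul_right_dvd hM) ?_
          · rw [← hn, natDegree_mul (left_ne_zero_of_mul hW0) (right_ne_zero_of_mul hW0)]
            omega
          · rw [Units.val_mul, Units.mul_inv_eq_iff_eq_mul, hu, hv, map_mul]
        have := T.mul_mem hu' hvT
        rwa [← QuotientGroup.mk_mul, inv_mul_cancel_right] at this
  rw [eq_top_iff]
  rintro x -
  obtain ⟨u, rfl⟩ := QuotientGroup.mk_surjective x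
  obtain ⟨N, W, hW, M, hM⟩ := exists_toQuat_of_unit hg u
  let r : (SInt S₀)ˣ := (hgu.pow N).unit
  let u' : (Quat c S₀)ˣ := Units.map (algebraMap (SInt S₀) (Quat c S₀)).toMonoidHom r * u
  have hu' : (u' : Quat c S₀) = toQuat c S₀ W := by
    rw [← hW, toQuat_coe]
    simp [u', r]
  have : cls u = cls u' := cls_eq_cls_iff.2 ⟨r, rfl⟩
  change cls u ∈ T
  rw [this]
  exact key _ W u' M rfl hM hu'

lemma natDegree_nrd_linear_zero_one : (nrd (linear 0 1 : PolyQuat c)).natDegree ≠ 0 := by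
  simp [nrd_linear]

lemma right_factor_quatF (hc : ¬ IsSquare c) {S₀ : Set F} {T : Subgroup (Lam c S₀)}
    (hs : elS c S₀ ∈ T) {W : PolyQuat c} {p : F[X]} (hp : Irreducible p) (hpX : p ∣ X)
    (hpW : p ∣ nrd W) :
    ∃ (W' V : PolyQuat c) (v : (Quat c S₀)ˣ), W = W' * V ∧ (nrd V).natDegree ≠ 0 ∧
      (v : Quat c S₀) = toQuat c S₀ V ∧ cls v ∈ T := by
  have hX : X ∣ nrd W := (hp.dvd_symm irreducible_X hpX).trans hpW
  obtain ⟨W', hW'⟩ := exists_eq_mul_quatF hc hX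
  exact ⟨W', linear 0 1, unitF c S₀, hW', natDegree_nrd_linear_zero_one,
    (toQuat_quatF S₀).symm, hs⟩

lemma eq_top_of_mem_empty (hc : ¬ IsSquare c) {T : Subgroup (Lam c (∅ : Set F))}
    (hd : ∀ δ : (Const c)ˣ, elD ∅ δ ∈ T) (hs : elS c ∅ ∈ T) : T = ⊤ := by
  refine eq_top_of_right_factors hc (g := X) ?_ (isUnit_t _) X_ne_zero T hd ?_
  · rintro v ⟨σ, hσ, hv⟩
    obtain rfl : σ = 0 := by simpa using hσ
    simpa using hv
  · exact fun W p hp hpX hpW => right_factor_quatF hc hs hp hpX hpW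

lemma mem_of_mem_places {τ : Fˣ} {v : HeightOneSpectrum F[X]} (hv : v ∈ places {(τ : F)}) :
    X * (1 - C ((τ⁻¹ : Fˣ) : F) * X) ∈ v.asIdeal := by
  obtain ⟨σ, hσ, hv⟩ := hv
  rcases hσ with rfl | rfl
  · exact v.asIdeal.mul_mem_right _ (by simpa using hv)
  · have h1 : (1 - C ((τ⁻¹ : Fˣ) : F) * X : F[X]) = -C ((τ⁻¹ : Fˣ) : F) * (X - C (τ : F)) := by
      have h2 : (C ((τ⁻¹ : Fˣ) : F) * C (τ : F) : F[X]) = 1 := by rw [← C_mul]; simp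
      linear_combination -h2
    rw [h1]
    exact v.asIdeal.mul_mem_left _ (v.asIdeal.mul_mem_left _ hv)

/-- Applied below to a normalizer, to the join of Γ_τ and Λ_B, and to the range of the map from the
presented group. -/
lemma eq_top_of_mem (hc : ¬ IsSquare c) {τ : Fˣ} {T : Subgroup (Lam c {(τ : F)})}
    (hd : ∀ δ : (Const c)ˣ, elD {(τ : F)} δ ∈ T) (hs : elS c {(τ : F)} ∈ T)
    (ha : PA c τ ⊆ T) : T = ⊤ := by
  have hdeg : (1 - C ((τ⁻¹ : Fˣ) : F) * X : F[X]).natDegree = 1 := by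
    rw [natDegree_sub_eq_right_of_natDegree_lt] <;> simp
  have h0 : (1 - C ((τ⁻¹ : Fˣ) : F) * X : F[X]) ≠ 0 := fun h => by
    rw [h, natDegree_zero] at hdeg
    exact zero_ne_one hdeg
  have hirr : Irreducible (1 - C ((τ⁻¹ : Fˣ) : F) * X : F[X]) := by
    refine irreducible_of_degree_eq_one ?_
    rw [degree_eq_natDegree h0, hdeg]
    rfl
  refine eq_top_of_right_factors hc (fun v => mem_of_mem_places)
    (by rw [map_mul]; exact (isUnit_t _).mul (isUnit_one_sub τ)) (mul_ne_zero X_ne_zero h0) T hd ?_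
  intro W p hp hpg hpW
  rcases hp.prime.dvd_or_dvd hpg with hpX | hpτ
  · exact right_factor_quatF hc hs hp hpX hpW
  have hev : (nrd W).eval (τ : F) = 0 :=
    eval_eq_zero_of_dvd_of_eval_eq_zero ((hp.dvd_symm hirr hpτ).trans hpW) (by simp)
  rcases exists_eq_mul_linear hc τ.ne_zero hev with ⟨W', hW'⟩ | ⟨α, W', hα, hW'⟩
  · rw [← Units.val_inv_eq_inv_val] at hW'
    refine ⟨W', _, Units.map (algebraMap (SInt {(τ : F)}) (Quat c {(τ : F)})).toMonoidHom
      (isUnit_one_sub τ).unit, hW', ?_, ?_, ?_⟩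
    · rw [nrd_coe, natDegree_pow, hdeg]
      norm_num
    · rw [toQuat_coe]
      rfl
    · have : cls (Units.map (algebraMap (SInt {(τ : F)}) (Quat c {(τ : F)})).toMonoidHom
          (isUnit_one_sub τ).unit) = 1 := cls_eq_one_iff.2 ⟨_, rfl⟩
      rw [this]
      exact T.one_mem
  · rw [← Units.val_inv_eq_inv_val] at hα
    refine ⟨W', linear 1 α, oneAdd τ α hα, hW', ?_, ?_, ha ⟨α, hα, rfl⟩⟩
    · rw [nrd_linear, map_one, C_1, hα, mul_comm, hdeg]
      norm_num
    · rw [toQuat_linear_one]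
      rfl

end Generation

/-! ### Reduced products of elements of `PA` -/

section Freeness

variable {F : Type*} [Field F] {c : F}

lemma quatIncl_toQuat {S₀ T₀ : Set F} (h : S₀ ⊆ T₀) (W : PolyQuat c) :
    quatIncl c h (toQuat c S₀ W) = toQuat c T₀ W := by
  ext1 <;> rfl

lemma constPart_coe_mul (τ : F) (p : F[X]) (W : PolyQuat c) :
    constPart τ ((p : PolyQuat c) * W) = p.eval τ • constPart τ W := by
  ext <;> simp [constPart]

/-- A polynomial element whose norm vanishes at `τ`, but which does not vanish there itself, does
not come from `Λ_B`. -/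
lemma cls_notMem_range_lamIncl {τ : Fˣ} {u : (Quat c {(τ : F)})ˣ} {A : PolyQuat c}
    (hu : (u : Quat c {(τ : F)}) = toQuat c {(τ : F)} A) (hA : (nrd A).eval (τ : F) = 0)
    (hA' : constPart (τ : F) A ≠ 0) :
    cls u ∉ (lamIncl c (Set.empty_subset {(τ : F)})).range := by
  rintro ⟨y, hy⟩
  obtain ⟨v, rfl⟩ := QuotientGroup.mk_surjective y
  obtain ⟨r, hr⟩ := cls_eq_cls_iff.1
    (show cls (Units.map (quatIncl c (Set.empty_subset {(τ : F)})).toMonoidHom v) = cls u from hy)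
  obtain ⟨N, W, hW, M, hM⟩ := exists_toQuat_of_unit (g := X) (S₀ := (∅ : Set F)) (by
    rintro v ⟨σ, hσ, hv⟩
    obtain rfl : σ = 0 := by simpa using hσ
    simpa using hv) v
  -- The norm of an element of Λ_B divides a power of t, hence does not vanish at τ.
  have hWτ : (nrd W).eval (τ : F) ≠ 0 := fun h => by
    have := eval_eq_zero_of_dvd_of_eval_eq_zero hM h
    simp at this
  have hW2 := congrArg (quatIncl c (Set.empty_subset {(τ : F)})) hW
  rw [map_mul, quatIncl_toQuat, quatIncl_toQuat] at hW2
  set x : RatFunc F := ((r : SInt {(τ : F)}) : RatFunc F) with hx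
  have hpq : poly {(τ : F)} x.denom * (r : SInt {(τ : F)}) = poly {(τ : F)} x.num := by
    ext1
    simp only [MulMemClass.coe_mul, coe_poly]
    rw [← hx, mul_comm]
    conv_lhs => enter [1]; rw [← RatFunc.num_div_denom x]
    exact div_mul_cancel₀ _ (by simpa using RatFunc.denom_ne_zero x)
  have hmain : ((x.denom * X ^ N : F[X]) : PolyQuat c) * A = ((x.num : F[X]) : PolyQuat c) * W := by
    apply toQuat_injective {(τ : F)}
    rw [map_mul, map_mul, ← hW2, ← hu, hr, toQuat_coe, toQuat_coe, toQuat_coe, ← mul_assoc,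
      ← mul_assoc, ← map_mul, ← map_mul, map_mul (poly _) x.denom, mul_right_comm, hpq]
    rfl
  -- Taking norms in `hmain` at τ makes the numerator of the scalar vanish; the residue of A then
  -- makes its denominator vanish too, contradicting coprimality.
  have hnum : x.num.eval (τ : F) = 0 := by
    have := congrArg (eval (τ : F)) (congrArg nrd hmain)
    rw [map_mul, map_mul, eval_mul, eval_mul, hA, mul_zero, nrd_coe, eval_pow, eq_comm,
      mul_eq_zero] at this
    exact pow_eq_zero_iff two_ne_zero |>.1 (this.resolve_right hWτ)
  have hden : x.denom.eval (τ : F) = 0 := by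
    by_contra hden
    apply hA'
    have h1 := congrArg (constPart (τ : F)) hmain
    rw [constPart_coe_mul, constPart_coe_mul, hnum, zero_smul, smul_eq_zero] at h1
    refine h1.resolve_left ?_
    rw [eval_mul, eval_pow, eval_X]
    exact mul_ne_zero hden (pow_ne_zero _ τ.ne_zero)
  exact not_isUnit_X_sub_C (τ : F) ((RatFunc.isCoprime_num_denom x).isUnit_of_dvd'
    (dvd_iff_isRoot.2 hnum) (dvd_iff_isRoot.2 hden))

/-- (1 + αF)(1 - αF) = 1 - τ⁻¹t is a scalar unit. -/
lemma elA_inv (τ : Fˣ) (α : Const c) (hα : α.norm = ((τ⁻¹ : Fˣ) : F)) :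
    (elA τ α hα)⁻¹ = elA τ (-α) ((QuadraticAlgebra.norm_neg α).trans hα) := by
  rw [elA, ← QuotientGroup.mk_inv]
  refine cls_eq_cls_iff.2 ⟨(isUnit_one_sub τ).unit, ?_⟩
  change _ = _ * ((1 - _) * algebraMap _ _ _)
  rw [← Algebra.commutes, ← mul_assoc, ← map_mul, Units.mul_inv, map_one, one_mul]
  change 1 + _ = _
  rw [map_neg]
  noncomm_ring

lemma elA_injective {τ : Fˣ} {α β : Const c} {hα : α.norm = ((τ⁻¹ : Fˣ) : F)}
    {hβ : β.norm = ((τ⁻¹ : Fˣ) : F)} (h : elA τ α hα = elA τ β hβ) : α = β := by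
  obtain ⟨r, hr⟩ := cls_eq_cls_iff.1 h
  change 1 + _ = _ * (1 + _) at hr
  rw [← toQuat_linear_one, ← toQuat_linear_one, ← Algebra.smul_def] at hr
  have h1 : (r : SInt {(τ : F)}) = 1 := by
    have := congrArg QuaternionAlgebra.re hr
    simpa [toQuat, linear, QuadraticAlgebra.re_one] using this.symm
  rw [h1, one_smul] at hr
  have := congrArg (fPart (τ : F)) (toQuat_injective _ hr)
  rw [fPart_linear, fPart_linear] at this
  exact this.symm

/-- A product of elements of `PA_τ` without adjacent inverses, modulo `t - τ`. -/
lemma exists_rep_of_isChain (hc : ¬ IsSquare c) {τ : Fˣ} (a : Lam c {(τ : F)})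
    (l : List (Lam c {(τ : F)})) (hl : ∀ b ∈ a :: l, b ∈ PA c τ)
    (hchain : (a :: l).IsChain fun a b => a * b ≠ 1) :
    ∃ (u : (Quat c {(τ : F)})ˣ) (W : PolyQuat c) (α : Const c)
      (hα : α.norm = ((τ⁻¹ : Fˣ) : F)), cls u = (a :: l).prod ∧
        (u : Quat c {(τ : F)}) = toQuat c {(τ : F)} W ∧ a = elA τ α hα ∧
        constPart (τ : F) W ≠ 0 ∧ fPart (τ : F) W = α * star (constPart (τ : F) W) := by
  induction l generalizing a with
  | nil =>
    obtain ⟨α, hα, rfl⟩ := hl a (by simp)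
    refine ⟨oneAdd τ α hα, linear 1 α, α, hα, by simp [elA], (toQuat_linear_one _ α).symm, rfl,
      ?_, ?_⟩
    · rw [constPart_linear]
      exact one_ne_zero
    · rw [constPart_linear, fPart_linear, star_one, mul_one]
  | cons b l ih =>
    obtain ⟨α, hα, rfl⟩ := hl a (by simp)
    rw [List.isChain_cons_cons] at hchain
    obtain ⟨u, W, β, hβ, hu, huW, rfl, hx, hf⟩ :=
      ih b (fun b' hb' => hl b' (List.mem_cons_of_mem _ hb')) hchain.2
    set x := constPart (τ : F) W
    -- This is the only use of the absence of adjacent inverses.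
    have hαβ : α + β ≠ 0 := fun h => hchain.1 <| by
      obtain rfl : β = -α := (neg_eq_of_add_eq_zero_right h).symm
      rw [← elA_inv τ α hα, mul_inv_cancel]
    have hτα : algebraMap F (Const c) τ * (α * star α) = 1 := by
      rw [← QuadraticAlgebra.algebraMap_norm_eq_mul_star, hα, ← map_mul, Units.mul_inv, map_one]
    have hA : constPart (τ : F) (linear 1 α * W) =
        (1 + algebraMap F (Const c) τ * (α * star β)) * x := by
      rw [constPart_mul, constPart_linear, fPart_linear, hf, star_mul, star_star]
      ring
    -- Since ταᾱ = 1, α(1 + τᾱβ) = α + β. This one identity gives the non-vanishing of the new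
    -- residue and the relation B = αĀ for the new first letter.
    have hA' : α * star (constPart (τ : F) (linear 1 α * W)) = (α + β) * star x := by
      have hst : star (algebraMap F (Const c) τ) = algebraMap F (Const c) τ := by
        ext <;> simp
      rw [hA]
      simp only [star_mul, star_add, star_one, star_star, hst]
      linear_combination (β * star x) * hτα
    have hx' : star x ≠ 0 := star_ne_zero.2 hx
    refine ⟨oneAdd τ α hα * u, linear 1 α * W, α, hα, ?_, ?_, rfl, fun h0 => ?_, ?_⟩
    · rw [List.prod_cons, ← hu, elA, ← QuotientGroup.mk_mul]
    · rw [Units.val_mul, huW, map_mul, toQuat_linear_one]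
      rfl
    · rw [h0, star_zero, mul_zero] at hA'
      have := congrArg QuadraticAlgebra.norm hA'
      rw [QuadraticAlgebra.norm_zero, map_mul, eq_comm, mul_eq_zero, norm_eq_zero_iff hc,
        norm_eq_zero_iff hc] at this
      exact this.elim hαβ hx'
    · rw [hA', fPart_mul, constPart_linear, fPart_linear, hf]
      ring

lemma prod_notMem_range_lamIncl (hc : ¬ IsSquare c) {τ : Fˣ} (l : List (Lam c {(τ : F)}))
    (hne : l ≠ []) (hl : ∀ b ∈ l, b ∈ PA c τ) (hchain : l.IsChain fun a b => a * b ≠ 1) :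
    l.prod ∉ (lamIncl c (Set.empty_subset {(τ : F)})).range := by
  cases l with
  | nil => exact absurd rfl hne
  | cons a l =>
    obtain ⟨u, W, α, hα, hu, huW, -, hx, hf⟩ := exists_rep_of_isChain hc a l hl hchain
    rw [← hu]
    refine cls_notMem_range_lamIncl huW ?_ hx
    -- With B = αĀ the norm at τ is N(A)(1 - τN(α)) = 0.
    rw [eval_nrd, hf, map_mul, hα, QuadraticAlgebra.norm_star, ← mul_assoc, Units.mul_inv, one_mul,
      sub_self]

end Freeness

/-! ### Norms and units of F[Z] over a finite field -/

section FiniteField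

variable {F : Type*} [Field F] {c : F}

lemma two_ne_zero_of_not_isSquare [Finite F] (hc : ¬ IsSquare c) : (2 : F) ≠ 0 :=
  Ring.two_ne_zero fun h => hc (FiniteField.isSquare_of_char_two h c)

/-- The constants of `F` among the units of `F[Z]`. -/
def baseUnits (c : F) : Subgroup (Const c)ˣ :=
  (Units.map (algebraMap F (Const c)).toMonoidHom).range

lemma mem_baseUnits_iff {z : (Const c)ˣ} : z ∈ baseUnits c ↔ (z : Const c).im = 0 := by
  constructor
  · rintro ⟨x, rfl⟩
    simp
  · intro h
    have hre : (z : Const c).re ≠ 0 := fun h0 => z.ne_zero (by ext <;> simp [h, h0])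
    refine ⟨Units.mk0 _ hre, ?_⟩
    ext <;> simp [h]

variable {q : ℕ}

lemma card_units_const (hq : Nat.card F = q) (hc : ¬ IsSquare c) :
    Nat.card (Const c)ˣ = q ^ 2 - 1 := by
  have : Fact (∀ r : F, r ^ 2 ≠ c + 0 * r) :=
    ⟨fun r hr => hc ⟨r, by rw [← sq, hr]; ring⟩⟩
  have h1 : Nat.card (Const c) = q ^ 2 := by
    rw [Nat.card_congr (QuadraticAlgebra.equivProd c 0), Nat.card_prod, hq, sq]
  have := Nat.card_units (Const c)
  rwa [h1] at this

lemma exists_generator [Finite F] (hc : ¬ IsSquare c) : ∃ δ : (Const c)ˣ, Subgroup.zpowers δ = ⊤ := by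
  have : Fact (∀ r : F, r ^ 2 ≠ c + 0 * r) :=
    ⟨fun r hr => hc ⟨r, by rw [← sq, hr]; ring⟩⟩
  have : Finite (Const c) := Finite.of_equiv _ (QuadraticAlgebra.equivProd c 0).symm
  have : IsCyclic (Const c)ˣ := inferInstance
  exact isCyclic_iff_exists_zpowers_eq_top.1 this

lemma card_baseUnits (hq : Nat.card F = q) : Nat.card (baseUnits c) = q - 1 := by
  rw [← hq, ← Nat.card_units F]
  refine (Nat.card_congr (MonoidHom.ofInjective (f := Units.map
    (algebraMap F (Const c)).toMonoidHom) ?_).toEquiv).symm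
  exact Units.map_injective QuadraticAlgebra.algebraMap_injective

/-- A power of a generator of `F[Z]ˣ` lies in `F` exactly for multiples of `q + 1`. -/
lemma im_zpow_eq_zero_iff [Finite F] (hq : Nat.card F = q) (hc : ¬ IsSquare c) {δ : (Const c)ˣ}
    (hδ : Subgroup.zpowers δ = ⊤) (i : ℤ) :
    ((δ ^ i : (Const c)ˣ) : Const c).im = 0 ↔ ((q + 1 : ℕ) : ℤ) ∣ i := by
  have hq1 : 1 < q := hq ▸ Finite.one_lt_card
  have hidx : (baseUnits c).index = q + 1 := by
    have h := (baseUnits c).card_mul_index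
    rw [card_baseUnits hq, card_units_const hq hc] at h
    have h2 : q ^ 2 - 1 = (q - 1) * (q + 1) := by
      obtain ⟨k, rfl⟩ : ∃ k, q = k + 1 := ⟨q - 1, by omega⟩
      simp only [Nat.add_sub_cancel]
      rw [show (k + 1) ^ 2 = k * (k + 1 + 1) + 1 by ring, Nat.add_sub_cancel]
    rw [h2] at h
    exact Nat.eq_of_mul_eq_mul_left (by omega) h
  -- The image of δ generates the quotient by the base units, of order (q² - 1)/(q - 1) = q + 1.
  have hord : orderOf (QuotientGroup.mk δ : (Const c)ˣ ⧸ baseUnits c) = q + 1 := by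
    rw [← hidx, Subgroup.index]
    refine orderOf_eq_card_of_forall_mem_zpowers fun x => ?_
    obtain ⟨y, rfl⟩ := QuotientGroup.mk_surjective x
    obtain ⟨j, rfl⟩ := Subgroup.mem_zpowers_iff.1 (hδ ▸ Subgroup.mem_top y)
    exact ⟨j, by simp⟩
  rw [← mem_baseUnits_iff, ← QuotientGroup.eq_one_iff, QuotientGroup.mk_zpow, ← hord,
    orderOf_dvd_iff_zpow_eq_one]

/-- Over a finite field of odd order, two quadratic polynomials in separate variables can be made to
sum to zero; here they are a² and -cb² - x. -/
lemma exists_norm_eq [Finite F] (hc : ¬ IsSquare c) (x : F) : ∃ α : Const c, α.norm = x := by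
  have hc0 : c ≠ 0 := fun h => hc (h ▸ IsSquare.zero)
  have := Fintype.ofFinite F
  obtain ⟨a, b, hab⟩ := FiniteField.exists_root_sum_quadratic (f := X ^ 2)
    (g := C (-c) * X ^ 2 + C 0 * X + C (-x)) (degree_X_pow 2)
    (degree_quadratic (neg_ne_zero.2 hc0))
    (FiniteField.odd_card_of_char_ne_two fun h => hc (FiniteField.isSquare_of_char_two h c))
  refine ⟨⟨a, b⟩, ?_⟩
  simp only [eval_add, eval_mul, eval_C, eval_pow, eval_X] at hab
  rw [QuadraticAlgebra.norm_def]
  linear_combination hab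

/-- Hilbert 90: two elements of the same nonzero norm differ by a factor `z / z̄`. -/
lemma exists_unit_mul_star_eq (hc : ¬ IsSquare c) {α β : Const c} (hα : α ≠ 0)
    (h : α.norm = β.norm) : ∃ z : (Const c)ˣ, β * star (z : Const c) = α * z := by
  suffices H : ∃ z : Const c, z ≠ 0 ∧ β * star z = α * z by
    obtain ⟨z, hz, h⟩ := H
    obtain ⟨w, hw⟩ := exists_mul_eq_one hc hz
    exact ⟨⟨z, w, hw, by rw [mul_comm, hw]⟩, h⟩
  obtain ⟨w, hw⟩ := exists_mul_eq_one hc hα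
  have hw' : star α * star w = 1 := by
    have := congrArg star hw
    rwa [star_mul, star_one, mul_comm] at this
  have hN : α * star α = β * star β := by
    rw [← QuadraticAlgebra.algebraMap_norm_eq_mul_star, h,
      QuadraticAlgebra.algebraMap_norm_eq_mul_star]
  -- The usual choice z = 1 + β/α fails only for β = -α, where z = Z works since Z̄ = -Z.
  by_cases hz : 1 + β * w = 0
  · have hβ : β = -α := by linear_combination α * hz - β * hw
    refine ⟨⟨0, 1⟩, fun h => one_ne_zero (congrArg QuadraticAlgebra.im h), ?_⟩
    rw [hβ]
    ext <;> simp
  · refine ⟨1 + β * w, hz, ?_⟩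
    rw [star_add, star_one, star_mul]
    linear_combination (-star w) * hN + (α) * hw' - β * hw

end FiniteField

/-! ### Relations between d, s and the elements of `PA` -/

section Relations

variable {F : Type*} [Field F] {c : F} {S₀ : Set F}

lemma elD_mul (z w : (Const c)ˣ) : elD S₀ (z * w) = elD S₀ z * elD S₀ w := by
  rw [elD, map_mul]
  rfl

lemma elD_one : elD S₀ (1 : (Const c)ˣ) = 1 := by
  rw [elD, map_one]
  rfl

/-- `z ↦ [z]` as a homomorphism. -/
def elDHom (c : F) (S₀ : Set F) : (Const c)ˣ →* Lam c S₀ where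
  toFun := elD S₀
  map_one' := elD_one
  map_mul' := elD_mul

lemma elD_zpow (z : (Const c)ˣ) (i : ℤ) : elD S₀ z ^ i = elD S₀ (z ^ i) :=
  (map_zpow (elDHom c S₀) z i).symm

lemma elD_inv (z : (Const c)ˣ) : (elD S₀ z)⁻¹ = elD S₀ z⁻¹ :=
  (map_inv (elDHom c S₀) z).symm

lemma elD_eq_one_iff {z : (Const c)ˣ} : elD S₀ z = 1 ↔ (z : Const c).im = 0 := by
  rw [elD, cls_eq_one_iff]
  constructor
  · rintro ⟨r, hr⟩
    have := congrArg QuaternionAlgebra.imI hr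
    change poly S₀ (C (z : Const c).im) = _ at this
    rw [QuaternionAlgebra.algebraMap_eq, ← map_zero (poly S₀)] at this
    exact C_eq_zero.1 (poly_injective this)
  · intro h
    have hre : (z : Const c).re ≠ 0 := fun h0 => z.ne_zero (by ext <;> simp [h, h0])
    refine ⟨Units.map ((poly S₀).comp C).toMonoidHom (Units.mk0 _ hre), ?_⟩
    change const c S₀ z = algebraMap _ _ (poly S₀ (C _))
    ext <;> simp [const, h, QuaternionAlgebra.algebraMap_eq]

lemma elS_sq : elS c S₀ ^ 2 = 1 := by
  rw [sq, elS, ← QuotientGroup.mk_mul, cls_eq_one_iff]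
  refine ⟨(isUnit_t S₀).unit, ?_⟩
  change quatF c S₀ * quatF c S₀ = _
  ext <;> simp [quatF, QuaternionAlgebra.algebraMap_eq]

lemma elS_mul_elD_ne_one (z : (Const c)ˣ) : elS c S₀ * elD S₀ z ≠ 1 := by
  rw [elS, elD, ← QuotientGroup.mk_mul, Ne, cls_eq_one_iff]
  rintro ⟨r, hr⟩
  change quatF c S₀ * const c S₀ z = _ at hr
  have := congrArg QuaternionAlgebra.re hr
  simp [quatF, const, QuaternionAlgebra.algebraMap_eq] at this
  exact r.ne_zero this.symm

/-- (Fz)² = z̄ F² z = N(z) t is a scalar unit. -/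
lemma elS_mul_elD_sq (z : (Const c)ˣ) : (elS c S₀ * elD S₀ z) ^ 2 = 1 := by
  have hN : IsUnit (poly S₀ (C (z : Const c).norm)) :=
    (QuadraticAlgebra.isUnit_iff_norm_isUnit.1 z.isUnit).map ((poly S₀).comp C)
  rw [sq, elS, elD, ← QuotientGroup.mk_mul, ← QuotientGroup.mk_mul, cls_eq_one_iff]
  refine ⟨(hN.mul (isUnit_t S₀)).unit, ?_⟩
  change quatF c S₀ * const c S₀ z * (quatF c S₀ * const c S₀ z) = _
  ext <;> simp [quatF, const, QuaternionAlgebra.algebraMap_eq, QuadraticAlgebra.norm_def] <;> ring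

/-- The F-coefficients of the two products are zα and βz̄. -/
lemma const_mul_linear (z α β : Const c) (h : β * star z = α * z) :
    linear z 0 * linear 1 α = linear 1 β * linear z 0 := by
  have h1 := congrArg C (congrArg QuadraticAlgebra.re h)
  have h2 := congrArg C (congrArg QuadraticAlgebra.im h)
  simp only [map_add, map_mul, map_neg, QuadraticAlgebra.re_mul, QuadraticAlgebra.im_mul, QuadraticAlgebra.re_star,
    QuadraticAlgebra.im_star, zero_mul, add_zero] at h1 h2
  ext1
  · simp [linear, QuadraticAlgebra.re_one, QuadraticAlgebra.im_one]
  · simp [linear, QuadraticAlgebra.re_one, QuadraticAlgebra.im_one]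
  · simp [linear, QuadraticAlgebra.re_one, QuadraticAlgebra.im_one]
    linear_combination -h1
  · simp [linear, QuadraticAlgebra.re_one, QuadraticAlgebra.im_one]
    linear_combination -h2

variable {τ : Fˣ}

lemma elD_mul_elA {z : (Const c)ˣ} {α β : Const c} (hα : α.norm = ((τ⁻¹ : Fˣ) : F))
    (hβ : β.norm = ((τ⁻¹ : Fˣ) : F)) (h : β * star (z : Const c) = α * z) :
    elD {(τ : F)} z * elA τ α hα = elA τ β hβ * elD {(τ : F)} z := by
  rw [elD, elA, elA, ← QuotientGroup.mk_mul, ← QuotientGroup.mk_mul]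
  congr 1
  ext1
  change const c _ z * (1 + _) = (1 + _) * const c _ z
  rw [← toQuat_linear_one, ← toQuat_linear_one, ← toQuat_linear_zero, ← map_mul, ← map_mul,
    const_mul_linear _ _ _ h]

lemma elS_mul_elA {α : Const c} (hα : α.norm = ((τ⁻¹ : Fˣ) : F)) :
    elS c {(τ : F)} * elA τ α hα =
      elA τ (star α) ((QuadraticAlgebra.norm_star α).trans hα) * elS c {(τ : F)} := by
  rw [elS, elA, elA, ← QuotientGroup.mk_mul, ← QuotientGroup.mk_mul]
  congr 1
  ext1
  change quatF c _ * (1 + _) = (1 + _) * quatF c _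
  rw [← toQuat_linear_one, ← toQuat_linear_one, ← toQuat_quatF, ← map_mul, ← map_mul]
  congr 1
  ext1 <;> simp [linear, QuadraticAlgebra.re_one, QuadraticAlgebra.im_one]

/-- `z / z̄` for a unit `z` of `F[Z]`. -/
def twist (z : (Const c)ˣ) : Const c := z * star ((z⁻¹ : (Const c)ˣ) : Const c)

lemma twist_mul_star (z : (Const c)ˣ) : twist z * star (z : Const c) = z := by
  have : star ((z⁻¹ : (Const c)ˣ) : Const c) * star (z : Const c) = 1 := by
    rw [← star_mul, Units.mul_inv, star_one]
  rw [twist, mul_assoc, this, mul_one]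

lemma norm_twist (z : (Const c)ˣ) : (twist z).norm = 1 := by
  rw [twist, map_mul, QuadraticAlgebra.norm_star, ← map_mul, Units.mul_inv, map_one]

lemma norm_mul_twist {α : Const c} (hα : α.norm = ((τ⁻¹ : Fˣ) : F)) (z : (Const c)ˣ) :
    (α * twist z).norm = ((τ⁻¹ : Fˣ) : F) := by
  rw [map_mul, norm_twist, mul_one, hα]

lemma elD_conj_elA {z : (Const c)ˣ} {α : Const c} (hα : α.norm = ((τ⁻¹ : Fˣ) : F)) :
    elD {(τ : F)} z * elA τ α hα * (elD {(τ : F)} z)⁻¹ =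
      elA τ (α * twist z) (norm_mul_twist hα z) := by
  rw [mul_inv_eq_iff_eq_mul]
  exact elD_mul_elA _ _ (by rw [mul_assoc, twist_mul_star])

lemma elD_zpow_conj_elA {z : (Const c)ˣ} {α : Const c} (hα : α.norm = ((τ⁻¹ : Fˣ) : F)) (i : ℤ) :
    elD {(τ : F)} z ^ i * elA τ α hα * elD {(τ : F)} z ^ (-i) =
      elA τ (α * twist (z ^ i)) (norm_mul_twist hα _) := by
  rw [zpow_neg, elD_zpow, elD_conj_elA]

end Relations

/-! ### Free basis, semidirect product and dihedral complement -/

section Structure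

variable {F : Type*} [Field F] {c : F} {τ : Fˣ}

lemma ne_zero_of_norm_eq {α : Const c} (hα : α.norm = ((τ⁻¹ : Fˣ) : F)) : α ≠ 0 := by
  rintro rfl
  exact (τ⁻¹).ne_zero (hα.symm.trans QuadraticAlgebra.norm_zero)

lemma inv_mem_PA {a : Lam c {(τ : F)}} (ha : a ∈ PA c τ) : a⁻¹ ∈ PA c τ := by
  obtain ⟨α, hα, rfl⟩ := ha
  exact ⟨-α, _, elA_inv τ α hα⟩

lemma inv_ne_self_of_mem_PA (h2 : (2 : F) ≠ 0) {a : Lam c {(τ : F)}} (ha : a ∈ PA c τ) :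
    a⁻¹ ≠ a := by
  obtain ⟨α, hα, rfl⟩ := ha
  rw [elA_inv]
  intro h
  have h3 : -α = α := elA_injective h
  refine ne_zero_of_norm_eq hα ?_
  ext
  · have := congrArg QuadraticAlgebra.re h3
    rw [QuadraticAlgebra.re_neg, neg_eq_iff_add_eq_zero, ← two_mul, mul_eq_zero] at this
    exact this.resolve_left h2
  · have := congrArg QuadraticAlgebra.im h3
    rw [QuadraticAlgebra.im_neg, neg_eq_iff_add_eq_zero, ← two_mul, mul_eq_zero] at this
    exact this.resolve_left h2

lemma twist_eq_one_iff (h2 : (2 : F) ≠ 0) {z : (Const c)ˣ} :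
    twist z = 1 ↔ (z : Const c).im = 0 := by
  have h1 : twist z = 1 ↔ star (z : Const c) = z := by
    constructor
    · intro h
      simpa [h] using twist_mul_star z
    · intro h
      have := twist_mul_star z
      rw [h] at this
      exact z.isUnit.mul_eq_right.1 this
  rw [h1]
  constructor
  · intro h
    have := congrArg QuadraticAlgebra.im h
    rw [QuadraticAlgebra.im_star, neg_eq_iff_add_eq_zero, ← two_mul, mul_eq_zero] at this
    exact this.resolve_left h2
  · intro h
    ext <;> simp [h]

/-- Conjugation by [z] multiplies α by z/z̄, and by Hilbert 90 such quotients relate any two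
elements of the same norm: the rotations act transitively on `PA`. -/
lemma mem_PA_iff (hc : ¬ IsSquare c) {δ : (Const c)ˣ} (hδ : Subgroup.zpowers δ = ⊤) {α : Const c}
    (hα : α.norm = ((τ⁻¹ : Fˣ) : F)) (x : Lam c {(τ : F)}) :
    x ∈ PA c τ ↔ ∃ i : ℤ, x = elD {(τ : F)} δ ^ i * elA τ α hα * elD {(τ : F)} δ ^ (-i) := by
  constructor
  · rintro ⟨β, hβ, rfl⟩
    obtain ⟨z, hz⟩ := exists_unit_mul_star_eq hc (ne_zero_of_norm_eq hα) (hα.trans hβ.symm)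
    obtain ⟨i, rfl⟩ := Subgroup.mem_zpowers_iff.1 (hδ ▸ Subgroup.mem_top z)
    refine ⟨i, ?_⟩
    rw [zpow_neg, eq_mul_inv_iff_mul_eq, elD_zpow, elD_mul_elA hα hβ hz]
  · rintro ⟨i, rfl⟩
    rw [elD_zpow_conj_elA]
    exact ⟨_, _, rfl⟩

variable {q : ℕ}

lemma elD_zpow_eq_one_iff [Finite F] (hq : Nat.card F = q) (hc : ¬ IsSquare c) {δ : (Const c)ˣ}
    (hδ : Subgroup.zpowers δ = ⊤) {S₀ : Set F} (i : ℤ) :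
    elD S₀ δ ^ i = 1 ↔ ((q + 1 : ℕ) : ℤ) ∣ i := by
  rw [elD_zpow, elD_eq_one_iff, im_zpow_eq_zero_iff hq hc hδ]

/-- The stabilizer of α consists of the powers of δ with z = z̄, that is, those in F. With
`mem_PA_iff` this makes the action of the rotations simply transitive. -/
lemma dvd_sub_of_conj_eq [Finite F] (hq : Nat.card F = q) (hc : ¬ IsSquare c) {δ : (Const c)ˣ}
    (hδ : Subgroup.zpowers δ = ⊤) {α : Const c} (hα : α.norm = ((τ⁻¹ : Fˣ) : F)) (i j : ℤ)
    (h : elD {(τ : F)} δ ^ i * elA τ α hα * elD {(τ : F)} δ ^ (-i) =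
      elD {(τ : F)} δ ^ j * elA τ α hα * elD {(τ : F)} δ ^ (-j)) :
    ((q + 1 : ℕ) : ℤ) ∣ i - j := by
  have h1 : elD {(τ : F)} δ ^ (i - j) * elA τ α hα * elD {(τ : F)} δ ^ (-(i - j)) =
      elA τ α hα := by
    rw [sub_eq_neg_add, neg_add, neg_neg, add_comm (-j) i, add_comm i, zpow_add, zpow_add]
    calc _ = elD {(τ : F)} δ ^ (-j) * (elD {(τ : F)} δ ^ i * elA τ α hα *
          elD {(τ : F)} δ ^ (-i)) * elD {(τ : F)} δ ^ j := by
          rw [(Commute.refl _).zpow_zpow j (-i)]; simp only [mul_assoc]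
      _ = _ := by rw [h]; simp [mul_assoc]
  rw [elD_zpow_conj_elA] at h1
  have h2 := elA_injective h1
  obtain ⟨w, hw⟩ := exists_mul_eq_one hc (ne_zero_of_norm_eq hα)
  rw [← im_zpow_eq_zero_iff hq hc hδ, ← twist_eq_one_iff (two_ne_zero_of_not_isSquare hc)]
  linear_combination w * h2 + (1 - twist (δ ^ (i - j))) * hw

lemma ncard_PA [Finite F] (hq : Nat.card F = q) (hc : ¬ IsSquare c) : (PA c τ).ncard = q + 1 := by
  obtain ⟨δ, hδ⟩ := exists_generator hc
  obtain ⟨α, hα⟩ := exists_norm_eq hc ((τ⁻¹ : Fˣ) : F)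
  have hmem := mem_PA_iff hc hδ hα
  refine Set.ncard_eq_of_bijective (fun (i : ℕ) _ => elD {(τ : F)} δ ^ (i : ℤ) * elA τ α hα *
    elD {(τ : F)} δ ^ (-(i : ℤ))) ?_ (fun i _ => (hmem _).2 ⟨i, rfl⟩) ?_
  · intro x hx
    obtain ⟨i, rfl⟩ := (hmem x).1 hx
    have h0 : ((q + 1 : ℕ) : ℤ) ≠ 0 := by positivity
    have hcast : (((i % ((q + 1 : ℕ) : ℤ)).toNat : ℕ) : ℤ) = i % ((q + 1 : ℕ) : ℤ) :=
      Int.toNat_of_nonneg (Int.emod_nonneg _ h0)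
    refine ⟨(i % ((q + 1 : ℕ) : ℤ)).toNat, ?_, ?_⟩
    · rw [← Int.ofNat_lt, hcast]
      exact Int.emod_lt_of_pos _ (by positivity)
    · have hz : elD {(τ : F)} δ ^ (i % ((q + 1 : ℕ) : ℤ)) = elD {(τ : F)} δ ^ i := by
        rw [← mul_inv_eq_one, ← zpow_neg, ← zpow_add, elD_zpow_eq_one_iff hq hc hδ]
        rw [← sub_eq_add_neg, ← dvd_neg, neg_sub]
        exact Int.dvd_self_sub_emod
      simp only [hcast, zpow_neg, hz]
  · intro i j hi hj h
    obtain ⟨k, hk⟩ := dvd_sub_of_conj_eq hq hc hδ hα _ _ h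
    have hk0 : k = 0 := by
      by_contra hk0
      have := Int.one_le_abs hk0
      have h3 : |(i : ℤ) - j| < ((q + 1 : ℕ) : ℤ) := by
        rw [abs_lt]; constructor <;> omega
      rw [hk, abs_mul, Nat.abs_cast] at h3
      nlinarith
    rw [hk0] at hk
    omega

lemma finite_PA [Finite F] (hq : Nat.card F = q) (hc : ¬ IsSquare c) : (PA c τ).Finite :=
  Set.finite_of_ncard_pos (by rw [ncard_PA hq hc]; omega)

lemma closure_eq_top_empty (hc : ¬ IsSquare c) {δ : (Const c)ˣ} (hδ : Subgroup.zpowers δ = ⊤) :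
    Subgroup.closure {elD (∅ : Set F) δ, elS c ∅} = ⊤ := by
  refine eq_top_of_mem_empty hc (fun z => ?_) (Subgroup.subset_closure (by simp))
  obtain ⟨i, rfl⟩ := Subgroup.mem_zpowers_iff.1 (hδ ▸ Subgroup.mem_top z)
  rw [← elD_zpow]
  exact Subgroup.zpow_mem _ (Subgroup.subset_closure (by simp)) i

lemma lamIncl_elD {S₀ T₀ : Set F} (h : S₀ ⊆ T₀) (z : (Const c)ˣ) :
    lamIncl c h (elD S₀ z) = elD T₀ z := by
  change cls _ = cls _
  congr 1

lemma lamIncl_elS {S₀ T₀ : Set F} (h : S₀ ⊆ T₀) : lamIncl c h (elS c S₀) = elS c T₀ := by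
  change cls _ = cls _
  congr 1
  ext1
  change quatIncl c h (quatF c S₀) = quatF c T₀
  rw [← toQuat_quatF, quatIncl_toQuat, toQuat_quatF]

lemma range_lamIncl (hc : ¬ IsSquare c) {δ : (Const c)ˣ} (hδ : Subgroup.zpowers δ = ⊤)
    {T₀ : Set F} : (lamIncl c (Set.empty_subset T₀)).range =
      Subgroup.closure {elD T₀ δ, elS c T₀} := by
  rw [MonoidHom.range_eq_map, ← closure_eq_top_empty hc hδ, MonoidHom.map_closure,
    Set.image_pair, lamIncl_elD, lamIncl_elS]

lemma lamIncl_injective {S₀ T₀ : Set F} (h : S₀ ⊆ T₀) : Function.Injective (lamIncl c h) := by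
  have hinj := Subalgebra.inclusion_injective (sInt_mono h)
  rw [injective_iff_map_eq_one]
  intro x hx
  obtain ⟨v, rfl⟩ := QuotientGroup.mk_surjective x
  obtain ⟨r, hr⟩ := cls_eq_one_iff.1
    (show cls (Units.map (quatIncl c h).toMonoidHom v) = 1 from hx)
  have hv : (v : Quat c S₀) = algebraMap (SInt S₀) (Quat c S₀) (v : Quat c S₀).re := by
    rw [QuaternionAlgebra.algebraMap_eq]
    ext1
    · rfl
    · exact hinj ((congrArg QuaternionAlgebra.imI hr).trans (map_zero _).symm)
    · exact hinj ((congrArg QuaternionAlgebra.imJ hr).trans (map_zero _).symm)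
    · exact hinj ((congrArg QuaternionAlgebra.imK hr).trans (map_zero _).symm)
  -- The scalar `r` is a unit only over the larger ring; over the smaller one, the real part of v⁻¹
  -- provides the inverse.
  have hunit : IsUnit (v : Quat c S₀).re := by
    refine IsUnit.of_mul_eq_one ((v⁻¹ : (Quat c S₀)ˣ) : Quat c S₀).re ?_
    have h1 := v.mul_inv
    rw [hv, ← Algebra.smul_def] at h1
    simpa using congrArg QuaternionAlgebra.re h1
  exact cls_eq_one_iff.2 ⟨hunit.unit, hv⟩

lemma normal_Gam (hc : ¬ IsSquare c) : (Gam c τ).Normal := by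
  rw [← Subgroup.normalizer_eq_top_iff]
  have hD : ∀ z : (Const c)ˣ, ∀ x ∈ PA c τ,
      elD {(τ : F)} z * x * (elD {(τ : F)} z)⁻¹ ∈ Subgroup.closure (PA c τ) := by
    rintro z _ ⟨α, hα, rfl⟩
    rw [elD_conj_elA]
    exact Subgroup.subset_closure ⟨_, _, rfl⟩
  have hS : ∀ x ∈ PA c τ,
      elS c {(τ : F)} * x * (elS c {(τ : F)})⁻¹ ∈ Subgroup.closure (PA c τ) := by
    rintro _ ⟨α, hα, rfl⟩
    rw [elS_mul_elA, mul_inv_cancel_right]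
    exact Subgroup.subset_closure ⟨_, _, rfl⟩
  have hS' : (elS c {(τ : F)})⁻¹ = elS c {(τ : F)} :=
    inv_eq_of_mul_eq_one_left (by rw [← sq, elS_sq])
  refine eq_top_of_mem hc (fun z => ?_) ?_ fun x hx => ?_
  · refine mem_normalizer_closure (hD z) ?_
    rw [elD_inv]
    exact hD z⁻¹
  · refine mem_normalizer_closure hS ?_
    rw [hS']
    exact hS
  · exact Subgroup.le_normalizer (Subgroup.subset_closure hx)

lemma disjoint_Gam [Finite F] (hc : ¬ IsSquare c) :
    Disjoint (Gam c τ) (lamIncl c (Set.empty_subset {(τ : F)})).range :=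
  disjoint_closure
    (fun _ ha => ⟨inv_mem_PA ha, inv_ne_self_of_mem_PA (two_ne_zero_of_not_isSquare hc) ha⟩) _
    (prod_notMem_range_lamIncl hc)

lemma isComplement'_Gam [Finite F] (hc : ¬ IsSquare c) :
    (Gam c τ).IsComplement' (lamIncl c (Set.empty_subset {(τ : F)})).range := by
  have := normal_Gam (τ := τ) hc
  refine Subgroup.isComplement'_of_disjoint_and_mul_eq_univ (disjoint_Gam hc) ?_
  have htop : Gam c τ ⊔ (lamIncl c (Set.empty_subset {(τ : F)})).range = ⊤ := by
    refine eq_top_of_mem hc (fun z => ?_) ?_ fun x hx => ?_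
    · exact Subgroup.mem_sup_right ⟨_, lamIncl_elD _ z⟩
    · exact Subgroup.mem_sup_right ⟨_, lamIncl_elS _⟩
    · exact Subgroup.mem_sup_left (Subgroup.subset_closure hx)
  rw [← Subgroup.normal_mul, htop]
  rfl

lemma lift_injective_of_isHalf (hc : ¬ IsSquare c) {X : Set (Lam c {(τ : F)})}
    (hX : IsHalf (PA c τ) X) :
    Function.Injective (FreeGroup.lift (Subtype.val : X → Lam c {(τ : F)})) :=
  hX.lift_injective (fun _ => inv_mem_PA) _ (prod_notMem_range_lamIncl hc)

lemma ncard_of_isHalf [Finite F] (hq : Nat.card F = q) (hc : ¬ IsSquare c) {X : Set (Lam c {(τ : F)})}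
    (hX : IsHalf (PA c τ) X) : X.ncard = (q + 1) / 2 := by
  have := hX.ncard_eq (fun _ => inv_mem_PA) (finite_PA hq hc)
  rw [ncard_PA hq hc] at this
  omega

lemma nonempty_freeGroup_mulEquiv_Gam [Finite F] (hq : Nat.card F = q) (hc : ¬ IsSquare c) :
    Nonempty (FreeGroup (Fin ((q + 1) / 2)) ≃* Gam c τ) := by
  obtain ⟨X, hX⟩ := exists_isHalf (P := PA c τ) fun _ ha =>
    ⟨inv_mem_PA ha, inv_ne_self_of_mem_PA (two_ne_zero_of_not_isSquare hc) ha⟩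
  have : Finite X := (finite_PA hq hc).subset hX.1
  let e : X ≃ Fin ((q + 1) / 2) := Finite.equivFinOfCardEq (ncard_of_isHalf hq hc hX)
  exact ⟨(FreeGroup.freeGroupCongr e.symm).trans
    ((MonoidHom.ofInjective (lift_injective_of_isHalf hc hX)).trans
      (MulEquiv.subgroupCongr hX.closure_eq))⟩

lemma exists_mulEquiv_dihedral_Lam [Finite F] (hq : Nat.card F = q) (hc : ¬ IsSquare c) {δ : (Const c)ˣ}
    (hδ : Subgroup.zpowers δ = ⊤) :
    ∃ e : Lam c (∅ : Set F) ≃* DihedralGroup (q + 1),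
      e (elD ∅ δ) = DihedralGroup.r 1 ∧ e (elS c ∅) = DihedralGroup.sr 0 :=
  exists_mulEquiv_dihedral (elD_zpow_eq_one_iff hq hc hδ) elS_sq (elS_mul_elD_sq δ)
    (fun i => by rw [elD_zpow]; exact elS_mul_elD_ne_one _) (closure_eq_top_empty hc hδ)

end Structure

/-! ### The presentation of Λ_τ -/

section Presentation

variable {F : Type*} [Field F] {c : F} {τ : Fˣ}

lemma elS_mul_elA_base {δ : (Const c)ˣ} {α₀ : Const c} (h : IsBase τ δ α₀)
    (hsq : IsSquare (τ : F)) :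
    elS c {(τ : F)} * elA τ α₀ h.norm_eq = elA τ α₀ h.norm_eq * elS c {(τ : F)} := by
  rcases h with ⟨-, x, hx, rfl⟩ | ⟨hns, -⟩
  · rw [elS_mul_elA]
    congr 2
    ext <;> simp
  · exact absurd hsq hns

/-- Conjugation by d turns α₀ = α₁δ⁻¹ into α₀δ/δ̄ = α₁/δ̄, and s conjugates this back to α₀. -/
lemma elS_mul_elD_mul_elA_base {δ : (Const c)ˣ} {α₀ : Const c} (h : IsBase τ δ α₀)
    (hsq : ¬ IsSquare (τ : F)) :
    elS c {(τ : F)} * elD {(τ : F)} δ * elA τ α₀ h.norm_eq =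
      elA τ α₀ h.norm_eq * (elS c {(τ : F)} * elD {(τ : F)} δ) := by
  have hstar : star (α₀ * twist δ) = α₀ := by
    rcases h with ⟨hs, -⟩ | ⟨-, x, hx, rfl⟩
    · exact absurd hs hsq
    · have hx' : star (algebraMap F (Const c) x) = algebraMap F (Const c) x := by
        ext <;> simp
      have h1 : star ((δ⁻¹ : (Const c)ˣ) : Const c) * star (δ : Const c) = 1 := by
        rw [← star_mul, Units.mul_inv, star_one]
      rw [twist]
      simp only [star_mul, star_star, hx']
      linear_combination (algebraMap F (Const c) x * ((δ⁻¹ : (Const c)ˣ) : Const c)) * h1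
  rw [mul_assoc, elD_mul_elA h.norm_eq (norm_mul_twist h.norm_eq δ)
    (by rw [mul_assoc, twist_mul_star]), ← mul_assoc, elS_mul_elA, mul_assoc]
  simp only [hstar]

variable {q : ℕ}

/-- For m = (q + 1)/2 the element δᵐ lies outside F but its square lies in F, so it is a multiple of
Z. Hence its conjugate is its negative, and conjugation by dᵐ sends α to -α, inverting [1 + αF]. -/
lemma elD_pow_mul_elA_sq [Finite F] (hq : Nat.card F = q) (hodd : Odd q) (hc : ¬ IsSquare c)
    {δ : (Const c)ˣ} (hδ : Subgroup.zpowers δ = ⊤) {α : Const c}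
    (hα : α.norm = ((τ⁻¹ : Fˣ) : F)) :
    (elD {(τ : F)} δ ^ ((q + 1) / 2) * elA τ α hα) ^ 2 = 1 := by
  obtain ⟨k, hk⟩ := hodd
  set m := (q + 1) / 2 with hm
  have hqm : q + 1 = m + m := by omega
  have h2 := two_ne_zero_of_not_isSquare hc
  have him : ((δ ^ m : (Const c)ˣ) : Const c).im ≠ 0 := by
    rw [← zpow_natCast, Ne, im_zpow_eq_zero_iff hq hc hδ]
    intro h
    have := Nat.le_of_dvd (by omega) (Int.natCast_dvd_natCast.1 h)
    omega
  have hre : ((δ ^ m : (Const c)ˣ) : Const c).re = 0 := by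
    have h1 : ((δ ^ (m + m) : (Const c)ˣ) : Const c).im = 0 := by
      rw [← zpow_natCast, im_zpow_eq_zero_iff hq hc hδ, hqm]
    rw [pow_add, Units.val_mul, QuadraticAlgebra.im_mul, zero_mul, zero_mul, add_zero,
      mul_comm _ (QuadraticAlgebra.re _), ← two_mul, mul_eq_zero, mul_eq_zero] at h1
    exact (h1.resolve_left h2).resolve_right him
  have hstar : star ((δ ^ m : (Const c)ˣ) : Const c) = -((δ ^ m : (Const c)ˣ) : Const c) := by
    ext <;> simp [-Units.val_pow_eq_pow_val, hre]
  have hpow : elD {(τ : F)} δ ^ m = elD {(τ : F)} (δ ^ m) := by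
    rw [← zpow_natCast, elD_zpow, zpow_natCast]
  have hconj : elD {(τ : F)} δ ^ m * elA τ α hα = (elA τ α hα)⁻¹ * elD {(τ : F)} δ ^ m := by
    rw [hpow, elA_inv]
    exact elD_mul_elA _ _ (by rw [hstar, neg_mul_neg])
  have hone : elD {(τ : F)} δ ^ m * elD {(τ : F)} δ ^ m = 1 := by
    rw [← pow_add, ← hqm, ← zpow_natCast, elD_zpow_eq_one_iff hq hc hδ]
  rw [sq]
  nth_rewrite 1 [hconj]
  rw [mul_assoc, ← mul_assoc (_ ^ m), hone, one_mul, inv_mul_cancel]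

lemma exists_mulEquiv_presentedGroup [Finite F] (hq : Nat.card F = q) (hodd : Odd q) (hc : ¬ IsSquare c)
    {δ : (Const c)ˣ} (hδ : Subgroup.zpowers δ = ⊤) {α₀ : Const c} (hα₀ : IsBase τ δ α₀) :
    ∃ e : PresentedGroup (relators q (IsSquare (τ : F))) ≃* Lam c {(τ : F)},
      e (PresentedGroup.of Gen.d) = elD {(τ : F)} δ ∧
      e (PresentedGroup.of Gen.s) = elS c {(τ : F)} ∧
      e (PresentedGroup.of Gen.a) = elA τ α₀ hα₀.norm_eq := by
  set R := relators q (IsSquare (τ : F)) with hR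
  have hα := hα₀.norm_eq
  let f : Gen → Lam c {(τ : F)} := fun g => match g with
    | .d => elD {(τ : F)} δ
    | .s => elS c {(τ : F)}
    | .a => elA τ α₀ hα
  have hf : ∀ r ∈ R, FreeGroup.lift f r = 1 := by
    rintro r (((rfl | rfl | rfl | rfl) | ⟨hsq, rfl⟩) | ⟨hsq, rfl⟩) <;>
      simp only [map_mul, map_pow, map_inv, FreeGroup.lift_apply_of, f]
    · rw [← zpow_natCast, elD_zpow_eq_one_iff hq hc hδ]
    · exact elS_sq
    · exact elS_mul_elD_sq δ
    · exact elD_pow_mul_elA_sq hq hodd hc hδ hα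
    · rw [mul_inv_eq_one, elS_mul_elA_base hα₀ hsq]
    · rw [mul_inv_eq_one, elS_mul_elD_mul_elA_base hα₀ hsq]
  let φ : PresentedGroup R →* Lam c {(τ : F)} := PresentedGroup.toGroup hf
  have hφd : φ (PresentedGroup.of Gen.d) = elD {(τ : F)} δ := PresentedGroup.toGroup.of hf
  have hφs : φ (PresentedGroup.of Gen.s) = elS c {(τ : F)} := PresentedGroup.toGroup.of hf
  have hφa : φ (PresentedGroup.of Gen.a) = elA τ α₀ hα := PresentedGroup.toGroup.of hf
  have hsurj : Function.Surjective φ := by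
    rw [← MonoidHom.range_eq_top]
    have hD : ∀ i : ℤ, elD {(τ : F)} δ ^ i ∈ φ.range := fun i =>
      Subgroup.zpow_mem φ.range ⟨_, hφd⟩ i
    refine eq_top_of_mem hc (fun z => ?_) ⟨_, hφs⟩ fun x hx => ?_
    · obtain ⟨i, rfl⟩ := Subgroup.mem_zpowers_iff.1 (hδ ▸ Subgroup.mem_top z)
      rw [← elD_zpow]
      exact hD i
    · obtain ⟨i, rfl⟩ := (mem_PA_iff hc hδ hα x).1 hx
      exact φ.range.mul_mem (φ.range.mul_mem (hD i) ⟨_, hφa⟩) (hD _)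
  have hinj : Function.Injective φ := by
    obtain ⟨X, hX⟩ := exists_isHalf (P := PA c τ) fun _ ha =>
      ⟨inv_mem_PA ha, inv_ne_self_of_mem_PA (two_ne_zero_of_not_isSquare hc) ha⟩
    set d : PresentedGroup R := PresentedGroup.of Gen.d
    set s : PresentedGroup R := PresentedGroup.of Gen.s
    set a : PresentedGroup R := PresentedGroup.of Gen.a
    have hs : s ^ 2 = 1 := PresentedGroup.one_of_mem (by simp [hR, relators])
    have hsd : (s * d) ^ 2 = 1 := PresentedGroup.one_of_mem (by simp [hR, relators])
    have hs' : s⁻¹ = s := inv_eq_of_mul_eq_one_left (by rw [← sq, hs])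
    -- Both forms of the last relation say that s conjugates a to a rotate of a: k = 0 for square τ,
    -- k = 1 otherwise.
    obtain ⟨k, hk⟩ : ∃ k : ℤ, s * a * s⁻¹ = d ^ k * a * d ^ (-k) := by
      by_cases hsq : IsSquare (τ : F)
      · have h : s * a = a * s := PresentedGroup.mk_eq_mk_of_mul_inv_mem
          (Or.inl (Or.inr ⟨hsq, rfl⟩))
        exact ⟨0, by rw [h]; simp⟩
      · have h : s * d * a = a * (s * d) := PresentedGroup.mk_eq_mk_of_mul_inv_mem
          (Or.inr ⟨hsq, rfl⟩)
        refine ⟨1, ?_⟩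
        have h3 : s * (d * a * d⁻¹) * s⁻¹ = a := by
          have h4 := mul_inv_eq_of_eq_mul h
          simpa only [mul_inv_rev, mul_assoc] using h4
        rw [zpow_neg, zpow_one]
        nth_rewrite 1 [← h3]
        simp only [hs', mul_assoc]
        rw [← sq, hs, mul_one, ← mul_assoc s, ← sq, hs, one_mul]
    refine injective_of_free_conjugates φ (d := d) (s := s) (a := a) (n := q + 1)
      (m := (q + 1) / 2) (k := k) ?_ ?_ hs hsd ?_ hk ?_ ?_ ?_ ?_ (P := PA c τ) (X := X) ?_ hX
      (lift_injective_of_isHalf hc hX) ?_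
    · obtain ⟨k, hk⟩ := hodd
      omega
    · exact PresentedGroup.one_of_mem (by simp [hR, relators])
    · exact PresentedGroup.one_of_mem (by simp [hR, relators])
    · rw [← PresentedGroup.closure_range_of R]
      congr 1
      ext x
      constructor
      · rintro (rfl | rfl | rfl)
        exacts [⟨_, rfl⟩, ⟨_, rfl⟩, ⟨_, rfl⟩]
      · rintro ⟨_ | _ | _, rfl⟩ <;> simp [d, s, a]
    · intro i
      rw [hφd, elD_zpow_eq_one_iff hq hc hδ]
      exact id
    · intro i
      rw [hφs, hφd, elD_zpow]
      exact elS_mul_elD_ne_one _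
    · rw [hφd, hφa]
      exact dvd_sub_of_conj_eq hq hc hδ hα
    · rw [hφd, hφa]
      exact mem_PA_iff hc hδ hα
    · rw [hφd, hφs, ← range_lamIncl hc hδ]
      exact disjoint_Gam hc
  exact ⟨MulEquiv.ofBijective φ ⟨hinj, hsurj⟩, hφd, hφs, hφa⟩

end Presentation

end

end QuatLattice

open QuatLattice

theorem theorem2p14 {F : Type*} [Field F] [Finite F] (q : ℕ) (hq : Nat.card F = q) (hodd : Odd q)
    (c : F) (hc : ¬ IsSquare c) (τ : Fˣ) :
    -- inverses of the generators
    (∀ (α : Const c) (hα : α.norm = ((τ⁻¹ : Fˣ) : F)),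
      (elA τ α hα)⁻¹ = elA τ (-α) ((QuadraticAlgebra.norm_neg α).trans hα)) ∧
    -- `Γ_τ` is free of rank `(q + 1) / 2` on `PA_τ`, a set of generators and their inverses
    (∀ a ∈ PA c τ, a⁻¹ ∈ PA c τ ∧ a⁻¹ ≠ a) ∧
    (∀ X : Set (Lam c {(τ : F)}), IsHalf (PA c τ) X →
      X.ncard = (q + 1) / 2 ∧
      Function.Injective (FreeGroup.lift (Subtype.val : X → Lam c {(τ : F)})) ∧
      (FreeGroup.lift (Subtype.val : X → Lam c {(τ : F)})).range = Gam c τ) ∧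
    Nonempty (FreeGroup (Fin ((q + 1) / 2)) ≃* Gam c τ) ∧
    -- `Λ_τ` is the internal semidirect product of the normal subgroup `Γ_τ` and of `Λ_B`
    (Gam c τ).Normal ∧
    Function.Injective (lamIncl c (Set.empty_subset {(τ : F)})) ∧
    (Gam c τ).IsComplement' (lamIncl c (Set.empty_subset {(τ : F)})).range ∧
    -- `Λ_B` is dihedral of order `2(q + 1)`, with rotation `d` and reflection `s`
    (∀ δ : (Const c)ˣ, Subgroup.zpowers δ = ⊤ →
      ∃ e : Lam c (∅ : Set F) ≃* DihedralGroup (q + 1),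
        e (elD ∅ δ) = DihedralGroup.r 1 ∧ e (elS c ∅) = DihedralGroup.sr 0) ∧
    -- the presentation of `Λ_τ` on `d`, `s`, `a_τ`
    (∀ δ : (Const c)ˣ, Subgroup.zpowers δ = ⊤ → ∀ (α₀ : Const c) (hα₀ : IsBase τ δ α₀),
      ∃ e : PresentedGroup (relators q (IsSquare (τ : F))) ≃* Lam c {(τ : F)},
        e (PresentedGroup.of Gen.d) = elD {(τ : F)} δ ∧
        e (PresentedGroup.of Gen.s) = elS c {(τ : F)} ∧
        e (PresentedGroup.of Gen.a) = elA τ α₀ hα₀.norm_eq) := by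
  refine ⟨elA_inv τ, fun a ha => ⟨inv_mem_PA ha,
    inv_ne_self_of_mem_PA (two_ne_zero_of_not_isSquare hc) ha⟩, fun X hX =>
    ⟨ncard_of_isHalf hq hc hX, lift_injective_of_isHalf hc hX, hX.closure_eq⟩,
    nonempty_freeGroup_mulEquiv_Gam hq hc, normal_Gam hc, lamIncl_injective _,
    isComplement'_Gam hc, fun δ hδ => exists_mulEquiv_dihedral_Lam hq hc hδ,
    fun δ hδ α₀ hα₀ => exists_mulEquiv_presentedGroup hq hodd hc hδ hα₀⟩
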